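/- Let $\alpha\in\mathbb R$ and $\beta\ge -1$, and set $D_\beta=\mathbb C$ if $\beta>-1$ and $D_{-1}=\mathbb C\setminus\{-1\}$. Let $\mathcal Y_{\alpha,\beta}$ be the class of all transcendental (i.e. non-rational) meromorphic functions $f$ in $\mathbb C$ with the following two properties, where convergence is locally uniform with respect to the spherical metric: (a) the family $(f_h)_{|h|\ge 1}$ of functions $f_h(z)=h^{-\alpha}f(h+h^{-\beta}z)$ (with any fixed determination of the powers, e.g. the principal values) is normal in $D_\beta$; (b) no limit function $\mathfrak f=\lim_{n\to\infty} f_{h_n}$ on $D_\beta$ with $h_n\to\infty$ is constant (the constant $\infty$ included). For a meromorphic function $g$ let $m(r,g)=\frac1{2\pi}\int_0^{2\pi}\log^+|g(re^{i\theta})|\,d\theta$ be the Nevanlinna proximity function. Then for every $f\in\mathcal Y_{\alpha,\beta}$ and every $c\in\mathbb C$, $$m\Big(r,\frac1{f-c}\Big)=O(\log r)\qquad(r\to\infty).$$ -/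

import Mathlib

open Filter Topology Set

noncomputable section

/-- The chordal metric on the Riemann sphere `ℂ ∪ {∞}`. -/
def chordalDist : OnePoint ℂ → OnePoint ℂ → ℝ
  | none, none => 0
  | none, some w => 2 / √(1 + ‖w‖ ^ 2)
  | some z, none => 2 / √(1 + ‖z‖ ^ 2)
  | some z, some w => 2 * ‖z - w‖ / (√(1 + ‖z‖ ^ 2) * √(1 + ‖w‖ ^ 2))

/-- Locally uniform convergence on the open set `U ⊆ ℂ` with respect to the spherical metric. -/
def SphericallyConvergesOn (F : ℕ → ℂ → OnePoint ℂ) (g : ℂ → OnePoint ℂ) (U : Set ℂ) : Prop :=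
  ∀ K ⊆ U, IsCompact K → ∀ ε > 0, ∀ᶠ n in atTop, ∀ z ∈ K, chordalDist (F n z) (g z) < ε

/-- Normality of a family of sphere-valued functions on the open set `U`: every sequence in the
family has a subsequence that converges locally uniformly on `U` with respect to the spherical
metric. -/
def IsNormalFamilyOn (𝓕 : Set (ℂ → OnePoint ℂ)) (U : Set ℂ) : Prop :=
  ∀ F : ℕ → ℂ → OnePoint ℂ, (∀ n, F n ∈ 𝓕) →
    ∃ φ : ℕ → ℕ, StrictMono φ ∧ ∃ g : ℂ → OnePoint ℂ,
      SphericallyConvergesOn (fun n ↦ F (φ n)) g U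

open Classical in
/-- A function `f : ℂ → ℂ`, meromorphic in Mathlib's sense, as a map to the Riemann sphere: the
value is `∞` at the poles, and the limit of `f` at all other points, whatever value `f` itself
happens to take there. -/
def toSphere (f : ℂ → ℂ) (z : ℂ) : OnePoint ℂ :=
  if meromorphicOrderAt f z < 0 then OnePoint.infty
  else ((toMeromorphicNFAt f z z : ℂ) : OnePoint ℂ)

/-- The value of `toSphere f` at `z` is the limit of `f` at `z` in the Riemann sphere. -/
theorem tendsto_toSphere {f : ℂ → ℂ} {z : ℂ} (hf : MeromorphicAt f z) :
    Tendsto (fun w ↦ ((f w : ℂ) : OnePoint ℂ)) (𝓝[≠] z) (𝓝 (toSphere f z)) := by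
  unfold toSphere
  split_ifs with h
  · have h1 := tendsto_cobounded_of_meromorphicOrderAt_neg h
    rw [Metric.cobounded_eq_cocompact] at h1
    have h2 : Tendsto ((↑) : ℂ → OnePoint ℂ) (cocompact ℂ) (𝓝 OnePoint.infty) := by
      rw [← coclosedCompact_eq_cocompact]
      exact OnePoint.tendsto_coe_infty
    exact h2.comp h1
  · have hNF : MeromorphicNFAt (toMeromorphicNFAt f z) z := meromorphicNFAt_toMeromorphicNFAt
    have hord : 0 ≤ meromorphicOrderAt (toMeromorphicNFAt f z) z := by
      rw [meromorphicOrderAt_congr hf.eq_nhdsNE_toMeromorphicNFAt.symm]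
      exact not_lt.mp h
    have han := hNF.meromorphicOrderAt_nonneg_iff_analyticAt.mp hord
    have h1 : Tendsto f (𝓝[≠] z) (𝓝 (toMeromorphicNFAt f z z)) :=
      (han.continuousAt.tendsto.mono_left nhdsWithin_le_nhds).congr'
        hf.eq_nhdsNE_toMeromorphicNFAt.symm
    exact (OnePoint.continuous_coe.tendsto _).comp h1

/-- `f` is a rational function (up to its values on a discrete closed set). -/
def IsRationalFunction (f : ℂ → ℂ) : Prop :=
  ∃ p q : Polynomial ℂ, q ≠ 0 ∧ f =ᶠ[codiscrete ℂ] fun z ↦ p.eval z / q.eval z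

/-- The re-scaled function `f_h(z) = h^{-α} f(h + h^{-β} z)`. The powers are principal values; other
determinations change `f_h` by a rotation of the variable and a unimodular factor, and lead to
the same class of functions below. -/
def yosidaRescale (α β : ℝ) (f : ℂ → ℂ) (h : ℂ) : ℂ → ℂ :=
  fun z ↦ h ^ (-(α : ℂ)) * f (h + h ^ (-(β : ℂ)) * z)

/-- The domain where the re-scaled functions have to form a normal family: `ℂ` for `β > -1`, and
`ℂ \ {-1}` for `β = -1`. -/
def yosidaDomain (β : ℝ) : Set ℂ := {z | β = -1 → z ≠ -1}

/-- The class of generalised Yosida functions with parameters `α` and `β` (where `β ≥ -1`). -/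
structure IsGeneralisedYosida (α β : ℝ) (f : ℂ → ℂ) : Prop where
  meromorphic : Meromorphic f
  transcendental : ¬ IsRationalFunction f
  /-- The family of all `f_h`, `|h| ≥ 1`, is normal. -/
  normal : IsNormalFamilyOn
    ((fun h ↦ toSphere (yosidaRescale α β f h)) '' {h : ℂ | 1 ≤ ‖h‖}) (yosidaDomain β)
  /-- No limit function for `h → ∞` is constant (the constant `∞` included). -/
  limit_nonconstant : ∀ (h : ℕ → ℂ) (g : ℂ → OnePoint ℂ),
    (∀ n, 1 ≤ ‖h n‖) → Tendsto (fun n ↦ ‖h n‖) atTop atTop →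
    SphericallyConvergesOn (fun n ↦ toSphere (yosidaRescale α β f (h n))) g (yosidaDomain β) →
    ¬ ∃ a : OnePoint ℂ, ∀ z ∈ yosidaDomain β, g z = a

end

/-! In the coordinate of $f_h$, the arc of $|z|=|h|$ through $h$ of angular half-width
$\sigma|h|^{-(1+\beta)}$ becomes a unit-speed curve through $0$ (`arcCurve`). There
$1/(f-c)=h^{-\alpha}/(f_h-h^{-\alpha}c)$. The factor $h^{-\alpha}$ contributes at most
$|\alpha|\log|h|$ to $\log^+$, so it remains to bound the integral of $\log^+|1/(f_h-h^{-\alpha}c)|$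
over the curve independently of $h$.

Take $h_n\to\infty$. By normality $f_{h_n}$ converges spherically along a subsequence, and
$h_n^{-\alpha}c$ converges on the sphere, possibly to $\infty$. Since the limit function is
nonconstant, the limiting equation has a zero of some finite order $k$ at $0$. By Hurwitz
(`exists_factorization_of_near`), $f_{h_n}-h_n^{-\alpha}c$ is, up to bounded factors, a product of
$k$ linear factors, whose logarithms have integrals bounded wherever their zeros lie
(`exists_lintegral_posLog_inv_sub_le`). Arguing by contradiction along a sequence gives one bound
for all large $|h|$ (`exists_lintegral_arc_le`).

The circle is covered by $O(r^{1+\beta})$ such arcs, each with angular contribution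
$r^{-(1+\beta)}O(\log r)$, and the sum is $O(\log r)$. -/

/-! ### Stable factorization near a zero of finite order. -/

/-- Hurwitz: a function close to one with a zero at `0` and none on a circle has a zero inside. -/
theorem exists_zero_of_near {ρ δ : ℝ} {H : ℂ → ℂ} (hδ : 0 < δ) (hδρ : δ < ρ)
    (hH : DifferentiableOn ℂ H (Metric.ball 0 ρ)) (h0 : H 0 = 0)
    (hne : ∀ z ∈ Metric.sphere (0 : ℂ) δ, H z ≠ 0) :
    ∃ ε > 0, ∀ F : ℂ → ℂ, DifferentiableOn ℂ F (Metric.ball 0 ρ) →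
      (∀ z ∈ Metric.ball (0 : ℂ) ρ, ‖F z - H z‖ < ε) →
      ∃ a ∈ Metric.closedBall (0 : ℂ) δ, F a = 0 := by
  have hsub : Metric.closedBall (0 : ℂ) δ ⊆ Metric.ball 0 ρ := Metric.closedBall_subset_ball hδρ
  have hcpt : IsCompact (Metric.sphere (0 : ℂ) δ) := isCompact_sphere 0 δ
  obtain ⟨z₀, hz₀, hmin⟩ := hcpt.exists_isMinOn (NormedSpace.sphere_nonempty.2 hδ.le)
    (hH.continuousOn.mono (Metric.sphere_subset_closedBall.trans hsub)).norm
  have hm : 0 < ‖H z₀‖ := norm_pos_iff.2 (hne z₀ hz₀)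
  refine ⟨‖H z₀‖ / 2, by positivity, fun F hF hFH ↦ ?_⟩
  -- Maximum principle for $1/F$: on the circle $|F|\ge m/2$ with $m=\min|H|$, while $|F(0)|<m/2$.
  by_contra! hcon
  have hinv : DiffContOnCl ℂ (fun z ↦ (F z)⁻¹) (Metric.ball 0 δ) := by
    apply DifferentiableOn.diffContOnCl
    rw [closure_ball _ hδ.ne']
    exact (hF.mono hsub).inv hcon
  have hfr : ∀ z ∈ frontier (Metric.ball (0 : ℂ) δ), ‖(F z)⁻¹‖ ≤ (‖H z₀‖ / 2)⁻¹ := by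
    intro z hz
    rw [frontier_ball _ hδ.ne'] at hz
    have h1 : ‖H z₀‖ ≤ ‖H z‖ := hmin hz
    have h2 := hFH z (hsub (Metric.sphere_subset_closedBall hz))
    have h3 : ‖H z‖ ≤ ‖F z‖ + ‖F z - H z‖ := by
      rw [norm_sub_rev]
      simpa [add_comm] using norm_add_le (F z) (H z - F z)
    rw [norm_inv]
    exact inv_anti₀ (by positivity) (by linarith)
  have h1 := Complex.norm_le_of_forall_mem_frontier_norm_le Metric.isBounded_ball hinv hfr
    (subset_closure (Metric.mem_ball_self hδ))
  have h2 := hFH 0 (Metric.mem_ball_self (hδ.trans hδρ))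
  rw [h0, sub_zero] at h2
  have h3 : 0 < ‖F 0‖ := norm_pos_iff.2 (hcon 0 (Metric.mem_closedBall_self hδ.le))
  rw [norm_inv] at h1
  have := (inv_le_inv₀ h3 (by positivity)).1 h1
  linarith

/-- Dividing out a small zero of `F` and the zero of `H` at `0` keeps the functions close. -/
theorem norm_dslope_sub_dslope_le {ρ R δ ε M : ℝ} {F H : ℂ → ℂ} {a : ℂ} (hR : 0 < R) (hRρ : R < ρ)
    (hδ : δ ≤ R / 2) (hF : DifferentiableOn ℂ F (Metric.ball 0 ρ))
    (hH : DifferentiableOn ℂ H (Metric.ball 0 ρ)) (h0 : H 0 = 0) (ha : ‖a‖ ≤ δ) (hFa : F a = 0)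
    (hFH : ∀ z ∈ Metric.ball (0 : ℂ) ρ, ‖F z - H z‖ < ε)
    (hM : ∀ z ∈ Metric.closedBall (0 : ℂ) R, ‖H z‖ ≤ M) {z : ℂ} (hz : ‖z‖ ≤ R) :
    ‖dslope F a z - dslope H 0 z‖ ≤ (R * ε + δ * M) / (R * (R / 2)) := by
  have hρ : 0 < ρ := hR.trans hRρ
  have hδ0 : 0 ≤ δ := (norm_nonneg a).trans ha
  have hsub : Metric.closedBall (0 : ℂ) R ⊆ Metric.ball 0 ρ := Metric.closedBall_subset_ball hRρ
  have haρ : Metric.ball (0 : ℂ) ρ ∈ 𝓝 a :=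
    Metric.isOpen_ball.mem_nhds (by simpa using by linarith)
  have hd : DiffContOnCl ℂ (fun z ↦ dslope F a z - dslope H 0 z) (Metric.ball 0 R) := by
    apply DifferentiableOn.diffContOnCl
    rw [closure_ball _ hR.ne']
    exact (((Complex.differentiableOn_dslope haρ).2 hF).sub ((Complex.differentiableOn_dslope
      (Metric.ball_mem_nhds 0 hρ)).2 hH)).mono hsub
  -- By the maximum principle only $|z|=R$ matters, where $|z-a|\ge R-\delta\ge R/2$.
  refine Complex.norm_le_of_forall_mem_frontier_norm_le Metric.isBounded_ball hd ?_
    (z := z) (by rw [closure_ball _ hR.ne']; simpa using hz)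
  intro z hz
  rw [frontier_ball _ hR.ne', mem_sphere_zero_iff_norm] at hz
  have hzR : z ∈ Metric.closedBall (0 : ℂ) R := by simp [hz]
  have hz0 : z ≠ 0 := by rw [← norm_pos_iff, hz]; exact hR
  have hza : R / 2 ≤ ‖z - a‖ := by
    have := norm_sub_norm_le z a
    linarith
  have hza0 : z - a ≠ 0 := by rw [← norm_pos_iff]; linarith
  have e1 : dslope F a z = F z / (z - a) := by
    have := sub_smul_dslope F a z
    rw [smul_eq_mul, hFa, sub_zero] at this
    rw [← this]; field_simp
  have e2 : dslope H 0 z = H z / z := by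
    have := sub_smul_dslope H 0 z
    rw [smul_eq_mul, h0, sub_zero, sub_zero] at this
    rw [← this]; field_simp
  have e3 : dslope F a z - dslope H 0 z = (z * (F z - H z) + a * H z) / (z * (z - a)) := by
    rw [e1, e2]; field_simp; ring
  rw [e3, norm_div, norm_mul z (z - a), hz]
  have h1 : ‖z * (F z - H z) + a * H z‖ ≤ R * ε + δ * M := by
    refine (norm_add_le _ _).trans (add_le_add ?_ ?_)
    · rw [norm_mul, hz]
      exact mul_le_mul_of_nonneg_left (hFH z (hsub hzR)).le hR.le
    · rw [norm_mul]
      exact mul_le_mul ha (hM z hzR) (norm_nonneg _) hδ0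
  exact div_le_div₀ ((norm_nonneg _).trans h1) h1 (by positivity) (by gcongr)

/-- All functions close to a function with a zero of order `k` at `0` are the product of `k` linear
factors and a function that is bounded away from zero. -/
theorem exists_factorization_of_near (k : ℕ) : ∀ {ρ : ℝ} {H : ℂ → ℂ}, 0 < ρ →
    DifferentiableOn ℂ H (Metric.ball 0 ρ) → analyticOrderAt H 0 = k →
    ∃ r > 0, r ≤ ρ ∧ ∃ c > 0, ∃ ε > 0, ∀ F : ℂ → ℂ, DifferentiableOn ℂ F (Metric.ball 0 ρ) →
      (∀ z ∈ Metric.ball (0 : ℂ) ρ, ‖F z - H z‖ < ε) →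
      ∃ s : Multiset ℂ, s.card = k ∧ ∃ K : ℂ → ℂ, ∀ z ∈ Metric.ball (0 : ℂ) r,
        F z = (s.map (z - ·)).prod * K z ∧ c ≤ ‖K z‖ := by
  induction k with
  | zero =>
    intro ρ H hρ hH hk
    have han : AnalyticAt ℂ H 0 := hH.analyticAt (Metric.ball_mem_nhds 0 hρ)
    have h0 : H 0 ≠ 0 := by
      rcases analyticOrderAt_eq_zero.1 (by simpa using hk) with h | h
      · exact absurd han h
      · exact h
    have hpos : 0 < ‖H 0‖ := norm_pos_iff.2 h0
    have hev : ∀ᶠ z in 𝓝 (0 : ℂ), ‖H 0‖ / 2 < ‖H z‖ :=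
      han.continuousAt.norm.eventually (lt_mem_nhds (by linarith))
    obtain ⟨r, hr, hrH⟩ := Metric.eventually_nhds_iff_ball.1 hev
    refine ⟨min r ρ, lt_min hr hρ, min_le_right _ _, ‖H 0‖ / 4, by positivity, ‖H 0‖ / 4,
      by positivity, fun F _ hFH ↦ ⟨0, rfl, F, fun z hz ↦ ⟨by simp, ?_⟩⟩⟩
    have h1 := hrH z (Metric.ball_subset_ball (min_le_left _ _) hz)
    have h2 := hFH z (Metric.ball_subset_ball (min_le_right _ _) hz)
    have h3 : ‖H z‖ ≤ ‖F z‖ + ‖F z - H z‖ := by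
      rw [norm_sub_rev]
      simpa [add_comm] using norm_add_le (F z) (H z - F z)
    linarith
  | succ k ih =>
    intro ρ H hρ hH hk
    have hnhds := Metric.ball_mem_nhds (0 : ℂ) hρ
    have han : AnalyticAt ℂ H 0 := hH.analyticAt hnhds
    have h0 : H 0 = 0 := by
      by_contra h
      have := analyticOrderAt_eq_zero.2 (Or.inr h)
      rw [this] at hk
      norm_cast at hk
    -- The induction passes from $H$ to $H/z$, of order $k$, and from $F$ to $F/(z-a)$, where $a$ is
    -- a Hurwitz zero of $F$. Closeness of the quotients is only known on $|z|\le R=3\rho/4$, so the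
    -- induction hypothesis is used with radius $\rho/2$.
    have hH' : DifferentiableOn ℂ (dslope H 0) (Metric.ball 0 ρ) :=
      (Complex.differentiableOn_dslope hnhds).2 hH
    have hk' : analyticOrderAt (dslope H 0) 0 = k := by
      have hmul : H = (fun z : ℂ ↦ z - 0) * dslope H 0 := by
        ext z
        simpa [h0] using (sub_smul_dslope H 0 z).symm
      have hid : analyticOrderAt (fun z : ℂ ↦ z - 0) 0 = 1 := by
        have : AnalyticAt ℂ (fun z : ℂ ↦ z - 0) 0 := by fun_prop
        have h := (this.analyticOrderAt_eq_natCast (n := 1)).2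
          ⟨fun _ ↦ 1, analyticAt_const, one_ne_zero, by simp⟩
        simpa using h
      have h := analyticOrderAt_mul (f := fun z : ℂ ↦ z - 0) (g := dslope H 0) (z₀ := 0)
        (by fun_prop) (hH'.analyticAt hnhds)
      rw [← hmul, hid, hk] at h
      have h' : (k : ℕ∞) + 1 = analyticOrderAt (dslope H 0) 0 + 1 := by
        rw [add_comm _ 1, add_comm _ 1]; simpa [add_comm] using h
      exact (ENat.add_left_injective_of_ne_top ENat.one_ne_top h').symm
    obtain ⟨r, hr, hrρ, c, hc, ε', hε', hih⟩ := ih (half_pos hρ)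
      (hH'.mono (Metric.ball_subset_ball (half_le_self hρ.le))) hk'
    set R := 3 * ρ / 4 with hRdef
    have hR : 0 < R := by positivity
    have hRρ : R < ρ := by linarith
    obtain ⟨M, hM⟩ := (isCompact_closedBall (0 : ℂ) R).exists_bound_of_continuousOn
      (hH.continuousOn.mono (Metric.closedBall_subset_ball hRρ))
    have hM0 : 0 ≤ M := (norm_nonneg _).trans (hM 0 (Metric.mem_closedBall_self hR.le))
    have hev : ∀ᶠ z in 𝓝[≠] (0 : ℂ), H z ≠ 0 := by
      refine han.eventually_eq_zero_or_eventually_ne_zero.resolve_left fun h ↦ ?_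
      rw [analyticOrderAt_eq_top.2 h] at hk
      exact ENat.top_ne_natCast _ hk
    obtain ⟨δ₀, hδ₀, hδ₀H⟩ := Metric.eventually_nhds_iff_ball.1 (eventually_nhdsWithin_iff.1 hev)
    -- The first bound keeps the circle free of zeros of $H$. The last one, with the choice of
    -- $\varepsilon$ below, makes $\delta M$ and $R\varepsilon$ each at most a quarter of
    -- $\varepsilon' R^2/2$.
    set δ := min (min (δ₀ / 2) (R / 2)) (ε' * (R * (R / 2)) / (4 * (M + 1))) with hδdef
    have hδ : 0 < δ := by positivity
    have hδ1 : δ ≤ δ₀ / 2 := (min_le_left _ _).trans (min_le_left _ _)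
    have hδ2 : δ ≤ R / 2 := (min_le_left _ _).trans (min_le_right _ _)
    have hδ3 : δ * (4 * (M + 1)) ≤ ε' * (R * (R / 2)) :=
      (le_div_iff₀ (by positivity)).1 (min_le_right _ _)
    obtain ⟨ε₁, hε₁, hzero⟩ := exists_zero_of_near hδ (by linarith) hH h0 (fun z hz ↦ by
      rw [mem_sphere_zero_iff_norm] at hz
      refine hδ₀H z (by simpa [hz] using by linarith) ?_
      rintro rfl
      simp at hz
      linarith)
    refine ⟨r, hr, by linarith, c, hc, min ε₁ (ε' * (R / 2) / 4), by positivity,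
      fun F hF hFH ↦ ?_⟩
    obtain ⟨a, ha, hFa⟩ := hzero F hF fun z hz ↦ (hFH z hz).trans_le (min_le_left _ _)
    rw [mem_closedBall_zero_iff] at ha
    have haρ : Metric.ball (0 : ℂ) ρ ∈ 𝓝 a :=
      Metric.isOpen_ball.mem_nhds (by simpa using by linarith)
    obtain ⟨s, hs, K, hK⟩ := hih (dslope F a)
      (((Complex.differentiableOn_dslope haρ).2 hF).mono
        (Metric.ball_subset_ball (half_le_self hρ.le))) (fun z hz ↦ by
      refine (norm_dslope_sub_dslope_le hR hRρ hδ2 hF hH h0 ha hFa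
        (fun z hz ↦ (hFH z hz).trans_le (min_le_right _ _)) hM (z := z) ?_).trans_lt ?_
      · rw [mem_ball_zero_iff] at hz; linarith
      · rw [div_lt_iff₀ (by positivity)]
        have : 0 < ε' * (R * (R / 2)) := by positivity
        nlinarith)
    refine ⟨a ::ₘ s, by simp [hs], K, fun z hz ↦ ⟨?_, (hK z hz).2⟩⟩
    have := sub_smul_dslope F a z
    rw [hFa, sub_zero, smul_eq_mul, (hK z hz).1] at this
    rw [← this, Multiset.map_cons, Multiset.prod_cons, mul_assoc]

/-! ### The Riemann sphere and spherical limits of meromorphic functions. -/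

noncomputable section

/-- First homogeneous coordinate of a point of the sphere, normalised to a unit vector of `ℂ²`. -/
def sphereNum : OnePoint ℂ → ℂ
  | none => 1
  | some z => z / (√(1 + ‖z‖ ^ 2) : ℝ)

/-- Second homogeneous coordinate of a point of the sphere, normalised to a unit vector of `ℂ²`. -/
def sphereDen : OnePoint ℂ → ℂ
  | none => 0
  | some z => 1 / (√(1 + ‖z‖ ^ 2) : ℝ)

/-- The inversion `z ↦ 1 / z` of the Riemann sphere. -/
def sphereInv : OnePoint ℂ → OnePoint ℂ
  | none => ((0 : ℂ) : OnePoint ℂ)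
  | some z => if z = 0 then OnePoint.infty else ((z⁻¹ : ℂ) : OnePoint ℂ)

@[simp] theorem sphereNum_infty : sphereNum OnePoint.infty = 1 := rfl

@[simp] theorem sphereDen_infty : sphereDen OnePoint.infty = 0 := rfl

theorem sphereNum_coe (z : ℂ) : sphereNum z = z / (√(1 + ‖z‖ ^ 2) : ℝ) := rfl

theorem sphereDen_coe (z : ℂ) : sphereDen z = 1 / (√(1 + ‖z‖ ^ 2) : ℝ) := rfl

@[simp] theorem sphereInv_infty : sphereInv OnePoint.infty = ((0 : ℂ) : OnePoint ℂ) := rfl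

theorem sphereInv_coe (z : ℂ) :
    sphereInv z = if z = 0 then OnePoint.infty else ((z⁻¹ : ℂ) : OnePoint ℂ) := rfl

theorem sphereInv_sphereInv (p : OnePoint ℂ) : sphereInv (sphereInv p) = p := by
  induction p using OnePoint.rec with
  | infty => simp [sphereInv_coe]
  | coe z => by_cases h : z = 0 <;> simp [sphereInv_coe, h]

theorem chordalDist_coe_coe (z w : ℂ) : chordalDist z w =
    2 * ‖z - w‖ / (√(1 + ‖z‖ ^ 2) * √(1 + ‖w‖ ^ 2)) := rfl

theorem chordalDist_coe_infty (z : ℂ) :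
    chordalDist z OnePoint.infty = 2 / √(1 + ‖z‖ ^ 2) := rfl

theorem norm_sphereNum_sq_add_norm_sphereDen_sq (p : OnePoint ℂ) :
    ‖sphereNum p‖ ^ 2 + ‖sphereDen p‖ ^ 2 = 1 := by
  induction p using OnePoint.rec with
  | infty => simp
  | coe z =>
    have h : (0 : ℝ) < 1 + ‖z‖ ^ 2 := by positivity
    rw [sphereNum_coe, sphereDen_coe, norm_div, norm_div, Complex.norm_real,
      Real.norm_of_nonneg (Real.sqrt_nonneg _), div_pow, div_pow, Real.sq_sqrt h.le, norm_one]
    field_simp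
    ring

/-- On the projective line the distance is twice the modulus of a determinant of unit vectors, which
treats $\infty$ like any other point. -/
theorem chordalDist_eq (p q : OnePoint ℂ) :
    chordalDist p q = 2 * ‖sphereNum p * sphereDen q - sphereDen p * sphereNum q‖ := by
  induction p using OnePoint.rec with
  | infty =>
    induction q using OnePoint.rec with
    | infty => simp; rfl
    | coe w =>
      change 2 / √(1 + ‖w‖ ^ 2) = _
      simp [sphereDen_coe, abs_of_nonneg (Real.sqrt_nonneg _), div_eq_mul_inv]
  | coe z =>
    induction q using OnePoint.rec with
    | infty =>
      rw [chordalDist_coe_infty]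
      simp [sphereDen_coe, abs_of_nonneg (Real.sqrt_nonneg _), div_eq_mul_inv]
    | coe w =>
      rw [chordalDist_coe_coe, sphereNum_coe, sphereNum_coe, sphereDen_coe, sphereDen_coe]
      have e : z / ((√(1 + ‖z‖ ^ 2) : ℝ) : ℂ) * (1 / ((√(1 + ‖w‖ ^ 2) : ℝ) : ℂ)) -
          1 / ((√(1 + ‖z‖ ^ 2) : ℝ) : ℂ) * (w / ((√(1 + ‖w‖ ^ 2) : ℝ) : ℂ)) =
          (z - w) / ((√(1 + ‖z‖ ^ 2) * √(1 + ‖w‖ ^ 2) : ℝ) : ℂ) := by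
        push_cast
        rw [div_mul_div_comm, div_mul_div_comm, ← sub_div]
        simp
      rw [e, norm_div, Complex.norm_real, Real.norm_of_nonneg (by positivity), mul_div_assoc]

theorem chordalDist_comm (p q : OnePoint ℂ) : chordalDist p q = chordalDist q p := by
  rw [chordalDist_eq, chordalDist_eq, norm_sub_rev, mul_comm (sphereDen p),
    mul_comm (sphereNum p)]

theorem chordalDist_triangle (p q r : OnePoint ℂ) :
    chordalDist p r ≤ chordalDist p q + chordalDist q r := by
  let L : OnePoint ℂ → EuclideanSpace ℂ (Fin 2) := fun p ↦ !₂[sphereNum p, sphereDen p]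
  let D : OnePoint ℂ → OnePoint ℂ → ℂ :=
    fun p q ↦ sphereNum p * sphereDen q - sphereDen p * sphereNum q
  have hL : ∀ p, ‖L p‖ = 1 := fun p ↦ by
    rw [EuclideanSpace.norm_eq]
    simp [L, norm_sphereNum_sq_add_norm_sphereDen_sq]
  -- Cramer's linear relation between three vectors of $\mathbb C^2$; for unit vectors, taking norms
  -- yields the triangle inequality.
  have hpl : D p r • L q = D p q • L r + D q r • L p := by
    ext i
    fin_cases i <;> simp [L, D] <;> ring
  have h := norm_add_le (D p q • L r) (D q r • L p)
  rw [← hpl, norm_smul, norm_smul, norm_smul, hL, hL, hL] at h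
  rw [chordalDist_eq, chordalDist_eq, chordalDist_eq]
  change 2 * ‖D p r‖ ≤ 2 * ‖D p q‖ + 2 * ‖D q r‖
  linarith

/-- Inversion swaps the homogeneous coordinates; the normalised ones match only up to a phase,
$|z|/z$ for finite $z\ne0$. -/
theorem exists_sphereNum_sphereInv (p : OnePoint ℂ) : ∃ u : ℂ, ‖u‖ = 1 ∧
    sphereNum (sphereInv p) = u * sphereDen p ∧ sphereDen (sphereInv p) = u * sphereNum p := by
  induction p using OnePoint.rec with
  | infty => exact ⟨1, by simp [sphereNum_coe, sphereDen_coe]⟩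
  | coe z =>
    by_cases hz : z = 0
    · exact ⟨1, by simp [hz, sphereInv_coe, sphereNum_coe, sphereDen_coe]⟩
    · have hz' : 0 < ‖z‖ := norm_pos_iff.2 hz
      have hzc : ((‖z‖ : ℝ) : ℂ) ≠ 0 := by exact_mod_cast hz'.ne'
      have hs : √(1 + ‖z⁻¹‖ ^ 2) = √(1 + ‖z‖ ^ 2) / ‖z‖ := by
        rw [eq_div_iff hz'.ne', ← Real.sqrt_sq hz'.le, ← Real.sqrt_mul (by positivity),
          Real.sqrt_sq hz'.le]
        congr 1
        rw [norm_inv]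
        field_simp
        ring
      have hr : ((√(1 + ‖z‖ ^ 2) : ℝ) : ℂ) ≠ 0 := by
        exact_mod_cast (Real.sqrt_pos.2 (by positivity)).ne'
      refine ⟨‖z‖ / z, by simp [hz], ?_⟩
      rw [sphereInv_coe, if_neg hz, sphereNum_coe, sphereDen_coe, sphereNum_coe, sphereDen_coe, hs]
      push_cast
      constructor <;> field_simp

theorem chordalDist_sphereInv (p q : OnePoint ℂ) :
    chordalDist (sphereInv p) (sphereInv q) = chordalDist p q := by
  obtain ⟨u, hu, h1, h2⟩ := exists_sphereNum_sphereInv p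
  obtain ⟨v, hv, h3, h4⟩ := exists_sphereNum_sphereInv q
  rw [chordalDist_eq, chordalDist_eq, h1, h2, h3, h4]
  have : u * sphereDen p * (v * sphereNum q) - u * sphereNum p * (v * sphereDen q) =
      -(u * v * (sphereNum p * sphereDen q - sphereDen p * sphereNum q)) := by ring
  rw [this, norm_neg, norm_mul, norm_mul, hu, hv, one_mul, one_mul]

theorem chordalDist_coe_coe_le (z w : ℂ) : chordalDist z w ≤ 2 * ‖z - w‖ := by
  rw [chordalDist_coe_coe]
  refine div_le_self (by positivity) ?_
  have h : ∀ z : ℂ, 1 ≤ √(1 + ‖z‖ ^ 2) := fun z ↦ by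
    rw [Real.one_le_sqrt]; nlinarith [sq_nonneg ‖z‖]
  nlinarith [h z, h w]

/-- Points at distance from `∞` are finite, with a bound. -/
theorem exists_coe_of_le_chordalDist_infty {p : OnePoint ℂ} {d : ℝ} (hd : 0 < d)
    (h : d ≤ chordalDist p OnePoint.infty) : ∃ z : ℂ, p = z ∧ √(1 + ‖z‖ ^ 2) ≤ 2 / d := by
  induction p using OnePoint.rec with
  | infty =>
    have : chordalDist OnePoint.infty OnePoint.infty = 0 := rfl
    linarith
  | coe z =>
    refine ⟨z, rfl, ?_⟩
    rw [chordalDist_coe_infty] at h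
    rw [le_div_iff₀ hd]
    have := (le_div_iff₀ (Real.sqrt_pos.2 (by positivity))).1 h
    linarith

theorem norm_sub_le_chordalDist {z w : ℂ} {M : ℝ} (hz : √(1 + ‖z‖ ^ 2) ≤ M)
    (hw : √(1 + ‖w‖ ^ 2) ≤ M) : ‖z - w‖ ≤ chordalDist z w * (M * M) := by
  have h1 : 0 < √(1 + ‖z‖ ^ 2) := Real.sqrt_pos.2 (by positivity)
  have h2 : 0 < √(1 + ‖w‖ ^ 2) := Real.sqrt_pos.2 (by positivity)
  have h3 : 2 * ‖z - w‖ = chordalDist z w * (√(1 + ‖z‖ ^ 2) * √(1 + ‖w‖ ^ 2)) := by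
    rw [chordalDist_coe_coe]; field_simp
  have h4 : 0 ≤ chordalDist z w := by rw [chordalDist_coe_coe]; positivity
  have h5 : chordalDist z w * (√(1 + ‖z‖ ^ 2) * √(1 + ‖w‖ ^ 2)) ≤ chordalDist z w * (M * M) := by
    have hM : 0 ≤ M := h1.le.trans hz
    gcongr
  nlinarith [norm_nonneg (z - w)]

theorem toSphere_of_analyticAt {f : ℂ → ℂ} {z : ℂ} (hf : AnalyticAt ℂ f z) :
    toSphere f z = f z := by
  rw [toSphere, if_neg (not_lt.2 hf.meromorphicOrderAt_nonneg),
    (toMeromorphicNFAt_eq_self (f := f) (x := z)).2 hf.meromorphicNFAt]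

/-- Infinite order must be excluded: with $0^{-1}=0$, the inverse of a function vanishing near $z$
again has the value $0$ on the sphere, not $\infty$. -/
theorem toSphere_inv {f : ℂ → ℂ} {z : ℂ} (hf : MeromorphicAt f z)
    (htop : meromorphicOrderAt f z ≠ ⊤) : toSphere f⁻¹ z = sphereInv (toSphere f z) := by
  have hval : toMeromorphicNFAt f⁻¹ z z = (toMeromorphicNFAt f z z)⁻¹ := by
    have h : toMeromorphicNFAt f⁻¹ z =ᶠ[𝓝[≠] z] (toMeromorphicNFAt f z)⁻¹ :=
      hf.inv.eq_nhdsNE_toMeromorphicNFAt.symm.trans hf.eq_nhdsNE_toMeromorphicNFAt.inv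
    exact ((meromorphicNFAt_toMeromorphicNFAt.eventuallyEq_nhdsNE_iff_eventuallyEq_nhds
      meromorphicNFAt_toMeromorphicNFAt.inv).1 h).eq_of_nhds
  have hzero := hf.meromorphicOrderAt_eq_zero_iff_toMeromorphicNFAt_ne_zero
  lift meromorphicOrderAt f z to ℤ using htop with k hk
  have hinv : meromorphicOrderAt f⁻¹ z = ((-k : ℤ) : WithTop ℤ) := by
    rw [meromorphicOrderAt_inv, ← hk]; rfl
  unfold toSphere
  rw [hinv, ← hk, hval]
  rcases lt_trichotomy k 0 with h | h | h
  · have h0 : toMeromorphicNFAt f z z = 0 := by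
      by_contra hne
      have := hzero.2 hne
      norm_cast at this
      omega
    rw [if_neg (by norm_cast; omega), if_pos (by exact_mod_cast h), h0]
    simp
  · subst h
    have h0 := hzero.1 rfl
    simp [sphereInv_coe, h0]
  · have h0 : toMeromorphicNFAt f z z = 0 := by
      by_contra hne
      have := hzero.2 hne
      norm_cast at this
      omega
    rw [if_pos (by norm_cast; omega), if_neg (by norm_cast; omega), h0]
    simp [sphereInv_coe]

theorem meromorphicOrderAt_toMeromorphicNFOn_univ {f : ℂ → ℂ} (hf : Meromorphic f) (z : ℂ) :
    meromorphicOrderAt (toMeromorphicNFOn f univ) z = meromorphicOrderAt f z :=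
  meromorphicOrderAt_toMeromorphicNFOn (fun z _ ↦ hf z) (mem_univ z)

theorem analyticAt_of_toSphere_ne_infty {f : ℂ → ℂ} (hf : Meromorphic f) {z : ℂ}
    (h : toSphere f z ≠ OnePoint.infty) : AnalyticAt ℂ (toMeromorphicNFOn f univ) z := by
  rw [← (meromorphicNFOn_toMeromorphicNFOn f univ (mem_univ z)).meromorphicOrderAt_nonneg_iff_analyticAt,
    meromorphicOrderAt_toMeromorphicNFOn_univ hf]
  by_contra hlt
  exact h (if_pos (not_le.1 hlt))

theorem toSphere_eq_coe_of_analyticAt {f : ℂ → ℂ} (hf : Meromorphic f) {z : ℂ}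
    (h : AnalyticAt ℂ (toMeromorphicNFOn f univ) z) :
    toSphere f z = (toMeromorphicNFOn f univ z : ℂ) := by
  have := h.meromorphicOrderAt_nonneg
  rw [meromorphicOrderAt_toMeromorphicNFOn_univ hf] at this
  rw [toSphere, if_neg (not_lt.2 this),
    toMeromorphicNFOn_eq_toMeromorphicNFAt (fun z _ ↦ hf z) (mem_univ z)]

theorem eventually_chordalDist_toSphere_lt_of_ne_infty {f : ℂ → ℂ} (hf : Meromorphic f) {z : ℂ}
    (h : toSphere f z ≠ OnePoint.infty) {ε : ℝ} (hε : 0 < ε) :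
    ∀ᶠ w in 𝓝 z, chordalDist (toSphere f w) (toSphere f z) < ε := by
  have han := analyticAt_of_toSphere_ne_infty hf h
  filter_upwards [han.eventually_analyticAt,
    han.continuousAt.eventually (Metric.ball_mem_nhds _ (half_pos hε))] with w hw hw'
  rw [toSphere_eq_coe_of_analyticAt hf hw, toSphere_eq_coe_of_analyticAt hf han]
  refine (chordalDist_coe_coe_le _ _).trans_lt ?_
  replace hw' : dist _ _ < ε / 2 := hw'
  rw [dist_eq_norm] at hw'
  linarith

/-- A meromorphic function is continuous as a map to the Riemann sphere. -/
theorem eventually_chordalDist_toSphere_lt {f : ℂ → ℂ} (hf : Meromorphic f)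
    (htop : ∀ z, meromorphicOrderAt f z ≠ ⊤) (z : ℂ) {ε : ℝ} (hε : 0 < ε) :
    ∀ᶠ w in 𝓝 z, chordalDist (toSphere f w) (toSphere f z) < ε := by
  by_cases h : toSphere f z = OnePoint.infty
  · have hinv : ∀ w, toSphere f⁻¹ w = sphereInv (toSphere f w) :=
      fun w ↦ toSphere_inv (hf w) (htop w)
    have h' : toSphere f⁻¹ z ≠ OnePoint.infty := by
      rw [hinv, h, sphereInv_infty]
      exact OnePoint.coe_ne_infty 0
    have := eventually_chordalDist_toSphere_lt_of_ne_infty (fun z ↦ (hf z).inv) h' hε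
    simpa only [hinv, chordalDist_sphereInv] using this
  · exact eventually_chordalDist_toSphere_lt_of_ne_infty hf h hε

/-- Near a point where it is finite, a spherical limit of meromorphic functions is the uniform limit
of analytic functions. -/
theorem exists_uniform_limit_of_ne_infty {f : ℕ → ℂ → ℂ} {g : ℂ → OnePoint ℂ} {U : Set ℂ}
    (hf : ∀ n, Meromorphic (f n)) (htop : ∀ n z, meromorphicOrderAt (f n) z ≠ ⊤) (hU : IsOpen U)
    (hg : SphericallyConvergesOn (fun n ↦ toSphere (f n)) g U) {z₀ : ℂ} (hz₀ : z₀ ∈ U)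
    (hfin : g z₀ ≠ OnePoint.infty) :
    ∃ ρ > 0, Metric.ball z₀ ρ ⊆ U ∧ ∃ G : ℂ → ℂ, DifferentiableOn ℂ G (Metric.ball z₀ ρ) ∧
      (∀ z ∈ Metric.ball z₀ ρ, g z = G z) ∧
      (∀ᶠ n in atTop, DifferentiableOn ℂ (toMeromorphicNFOn (f n) univ) (Metric.ball z₀ ρ) ∧
        ∀ z ∈ Metric.ball z₀ ρ, toSphere (f n) z = (toMeromorphicNFOn (f n) univ z : ℂ)) ∧
      TendstoUniformlyOn (fun n ↦ toMeromorphicNFOn (f n) univ) G atTop (Metric.ball z₀ ρ) := by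
  obtain ⟨w, hw⟩ := OnePoint.ne_infty_iff_exists.1 hfin
  -- Half the chordal distance from $g(z_0)$ to $\infty$: points within $d$ of $g(z_0)$ are finite
  -- and uniformly bounded, so there the two metrics are comparable.
  set d : ℝ := 1 / √(1 + ‖w‖ ^ 2) with hd
  have hd0 : 0 < d := one_div_pos.2 (Real.sqrt_pos.2 (by positivity))
  have hwd : chordalDist (g z₀) OnePoint.infty = 2 * d := by
    rw [← hw, chordalDist_coe_infty, hd]; ring
  obtain ⟨r, hr, hrU⟩ := Metric.isOpen_iff.1 hU z₀ hz₀
  have hcb : Metric.closedBall z₀ (r / 2) ⊆ U :=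
    (Metric.closedBall_subset_ball (half_lt_self hr)).trans hrU
  have hconv := hg _ hcb (isCompact_closedBall _ _)
  obtain ⟨N, hN⟩ := eventually_atTop.1 (hconv (d / 4) (by positivity))
  obtain ⟨ρ', hρ', hρ'N⟩ := Metric.eventually_nhds_iff_ball.1
    (eventually_chordalDist_toSphere_lt (hf N) (htop N) z₀ (ε := d / 4) (by positivity))
  set ρ := min ρ' (r / 2) with hρ
  have hρ0 : 0 < ρ := by positivity
  have hsub : Metric.ball z₀ ρ ⊆ Metric.closedBall z₀ (r / 2) :=
    (Metric.ball_subset_ball (min_le_right _ _)).trans Metric.ball_subset_closedBall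
  -- Continuity of $g$ at $z_0$ is inherited from the single function $f_N$; the last quarter of $d$
  -- is left for $f_n$ with $n\ge N$.
  have hgz : ∀ z ∈ Metric.ball z₀ ρ, chordalDist (g z₀) (g z) < 3 * (d / 4) := by
    intro z hz
    have h1 := hN N le_rfl z₀ (Metric.mem_closedBall_self (by positivity))
    have h2 := hN N le_rfl z (hsub hz)
    have h3 := hρ'N z (Metric.ball_subset_ball (min_le_left _ _) hz)
    have h4 := chordalDist_triangle (g z₀) (toSphere (f N) z₀) (g z)
    have h5 := chordalDist_triangle (toSphere (f N) z₀) (toSphere (f N) z) (g z)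
    rw [chordalDist_comm] at h1 h3
    linarith
  have key : ∀ p, chordalDist (g z₀) p < d → ∃ z : ℂ, p = z ∧ √(1 + ‖z‖ ^ 2) ≤ 2 / d := by
    intro p hp
    refine exists_coe_of_le_chordalDist_infty hd0 ?_
    have := chordalDist_triangle (g z₀) p OnePoint.infty
    linarith
  have hG : ∀ z : ℂ, ∃ v : ℂ, z ∈ Metric.ball z₀ ρ → g z = v ∧ √(1 + ‖v‖ ^ 2) ≤ 2 / d := by
    intro z
    by_cases hz : z ∈ Metric.ball z₀ ρ
    · obtain ⟨v, hv⟩ := key (g z) (by linarith [hgz z hz])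
      exact ⟨v, fun _ ↦ hv⟩
    · exact ⟨0, fun h ↦ absurd h hz⟩
  choose G hG using hG
  have hFn : ∀ n ≥ N, ∀ z ∈ Metric.ball z₀ ρ,
      AnalyticAt ℂ (toMeromorphicNFOn (f n) univ) z ∧
      toSphere (f n) z = (toMeromorphicNFOn (f n) univ z : ℂ) ∧
      √(1 + ‖toMeromorphicNFOn (f n) univ z‖ ^ 2) ≤ 2 / d := by
    intro n hn z hz
    have h1 := hN n hn z (hsub hz)
    have h2 := chordalDist_triangle (g z₀) (g z) (toSphere (f n) z)
    rw [chordalDist_comm] at h1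
    obtain ⟨v, hv, hvd⟩ := key (toSphere (f n) z) (by linarith [hgz z hz])
    have han := analyticAt_of_toSphere_ne_infty (hf n) (z := z)
      (by rw [hv]; exact OnePoint.coe_ne_infty v)
    have heq := toSphere_eq_coe_of_analyticAt (hf n) han
    refine ⟨han, heq, ?_⟩
    rw [heq, OnePoint.coe_eq_coe] at hv
    rwa [hv]
  have hdiff : ∀ᶠ n in atTop,
      DifferentiableOn ℂ (toMeromorphicNFOn (f n) univ) (Metric.ball z₀ ρ) ∧
        ∀ z ∈ Metric.ball z₀ ρ, toSphere (f n) z = (toMeromorphicNFOn (f n) univ z : ℂ) :=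
    eventually_atTop.2 ⟨N, fun n hn ↦ ⟨fun z hz ↦
      (hFn n hn z hz).1.differentiableAt.differentiableWithinAt, fun z hz ↦ (hFn n hn z hz).2.1⟩⟩
  have hunif : TendstoUniformlyOn (fun n ↦ toMeromorphicNFOn (f n) univ) G atTop
      (Metric.ball z₀ ρ) := by
    rw [Metric.tendstoUniformlyOn_iff]
    intro ε hε
    filter_upwards [eventually_ge_atTop N, hconv (ε / (2 / d * (2 / d))) (by positivity)]
      with n hn hnc z hz
    have h1 := hnc z (hsub hz)
    rw [(hFn n hn z hz).2.1, (hG z hz).1] at h1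
    rw [dist_comm, dist_eq_norm]
    refine (norm_sub_le_chordalDist (hFn n hn z hz).2.2 (hG z hz).2).trans_lt ?_
    exact (lt_div_iff₀ (by positivity)).1 h1
  refine ⟨ρ, hρ0, hsub.trans hcb, G, ?_, fun z hz ↦ (hG z hz).1, hdiff, hunif⟩
  exact hunif.tendstoLocallyUniformlyOn.differentiableOn (hdiff.mono fun n h ↦ h.1)
    Metric.isOpen_ball

theorem SphericallyConvergesOn.sphereInv {F : ℕ → ℂ → OnePoint ℂ} {g : ℂ → OnePoint ℂ} {U : Set ℂ}
    (h : SphericallyConvergesOn F g U) :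
    SphericallyConvergesOn (fun n z ↦ sphereInv (F n z)) (fun z ↦ sphereInv (g z)) U := by
  intro K hKU hK ε hε
  simpa only [chordalDist_sphereInv] using h K hKU hK ε hε

theorem SphericallyConvergesOn.toSphere_inv {f : ℕ → ℂ → ℂ} {g : ℂ → OnePoint ℂ} {U : Set ℂ}
    (hf : ∀ n, Meromorphic (f n)) (htop : ∀ n z, meromorphicOrderAt (f n) z ≠ ⊤)
    (h : SphericallyConvergesOn (fun n ↦ toSphere (f n)) g U) :
    SphericallyConvergesOn (fun n ↦ toSphere (f n)⁻¹) (fun z ↦ _root_.sphereInv (g z)) U := by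
  have e : (fun n ↦ toSphere (f n)⁻¹) = fun n z ↦ _root_.sphereInv (toSphere (f n) z) := by
    funext n z
    exact _root_.toSphere_inv (hf n z) (htop n z)
  rw [e]
  exact h.sphereInv

/-- Identity theorem: a spherical limit of meromorphic functions on a connected open set that is
constant near one point is constant. -/
theorem SphericallyConvergesOn.eqOn_const {f : ℕ → ℂ → ℂ} {g : ℂ → OnePoint ℂ} {U : Set ℂ}
    (hf : ∀ n, Meromorphic (f n)) (htop : ∀ n z, meromorphicOrderAt (f n) z ≠ ⊤) (hU : IsOpen U)
    (hUc : IsPreconnected U) (hg : SphericallyConvergesOn (fun n ↦ toSphere (f n)) g U)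
    {z₀ : ℂ} (hz₀ : z₀ ∈ U) {a : OnePoint ℂ} (ha : ∀ᶠ z in 𝓝 z₀, g z = a) :
    ∀ z ∈ U, g z = a := by
  have aux : ∀ (G : ℂ → ℂ) (z : ℂ) (ρ : ℝ), 0 < ρ → DifferentiableOn ℂ G (Metric.ball z ρ) →
      ∀ b, (∃ w ∈ Metric.ball z ρ, ∀ᶠ w' in 𝓝 w, (G w' : OnePoint ℂ) = b) →
      ∀ w ∈ Metric.ball z ρ, (G w : OnePoint ℂ) = b := by
    rintro G z ρ hρ hG b ⟨w, hw, hwb⟩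
    have hb : b = (G w : OnePoint ℂ) := hwb.self_of_nhds.symm
    subst hb
    have := (hG.analyticOnNhd Metric.isOpen_ball).eqOn_of_preconnected_of_eventuallyEq
      (g := fun _ ↦ G w) analyticOnNhd_const (convex_ball z ρ).isPreconnected hw
      (hwb.mono fun w' h ↦ OnePoint.coe_injective h)
    exact fun w' hw' ↦ congrArg _ (this hw')
  have hopen : IsOpen {z | ∀ᶠ w in 𝓝 z, g w = a} := isOpen_setOfPred_eventually_nhds
  -- The set where $g$ is locally $a$ is relatively closed in $U$: near a limit point, $g$ or $1/g$
  -- is analytic on a disc, and `aux` applies there.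
  have hsub := hUc.subset_of_closure_inter_subset hopen ⟨z₀, hz₀, ha⟩ (by
    rintro z ⟨hzc, hzU⟩
    by_cases hfin : g z = OnePoint.infty
    · obtain ⟨ρ, hρ, -, G, hG, hgG, -⟩ := exists_uniform_limit_of_ne_infty
        (fun n z ↦ (hf n z).inv) (fun n z ↦ by
          rw [meromorphicOrderAt_inv, ne_eq, LinearOrderedAddCommGroupWithTop.neg_eq_top]
          exact htop n z) hU (hg.toSphere_inv hf htop) hzU (by
          rw [hfin, sphereInv_infty]; exact OnePoint.coe_ne_infty 0)
      obtain ⟨w, hw, hwS⟩ := Metric.mem_closure_iff.1 hzc ρ hρ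
      have hwb : w ∈ Metric.ball z ρ := by rwa [Metric.mem_ball, dist_comm]
      have := aux G z ρ hρ hG (_root_.sphereInv a) ⟨w, hwb, by
        filter_upwards [Metric.isOpen_ball.mem_nhds hwb, hw] with w' h1 h2
        rw [← hgG w' h1, h2]⟩
      filter_upwards [Metric.ball_mem_nhds z hρ] with w' hw'
      rw [← sphereInv_sphereInv (g w'), hgG w' hw', this w' hw', sphereInv_sphereInv]
    · obtain ⟨ρ, hρ, -, G, hG, hgG, -⟩ := exists_uniform_limit_of_ne_infty hf htop hU hg hzU hfin
      obtain ⟨w, hw, hwS⟩ := Metric.mem_closure_iff.1 hzc ρ hρ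
      have hwb : w ∈ Metric.ball z ρ := by rwa [Metric.mem_ball, dist_comm]
      have := aux G z ρ hρ hG a ⟨w, hwb, by
        filter_upwards [Metric.isOpen_ball.mem_nhds hwb, hw] with w' h1 h2
        rw [← hgG w' h1, h2]⟩
      filter_upwards [Metric.ball_mem_nhds z hρ] with w' hw'
      rw [hgG w' hw', this w' hw'])
  exact fun z hz ↦ (hsub hz).self_of_nhds

end

/-! ### Logarithmic integrals along curves, and bounds for $1/(f_n-c_n)$. -/

noncomputable section

/-- The logarithmic singularity is integrable along curves satisfying a lower Lipschitz bound,
uniformly in the curve and in the position of the singularity. -/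
theorem exists_lintegral_posLog_inv_sub_le : ∃ C : NNReal, ∀ (γ : ℝ → ℂ), Continuous γ →
    (∀ t ∈ Icc (-1 : ℝ) 1, ∀ t' ∈ Icc (-1 : ℝ) 1, |t - t'| / 2 ≤ ‖γ t - γ t'‖) → ∀ a : ℂ,
    ∫⁻ t in Icc (-1 : ℝ) 1, ENNReal.ofReal (Real.posLog ‖(γ t - a)⁻¹‖) ≤ C := by
  let φ : ℝ → ENNReal := fun u ↦ ENNReal.ofReal (Real.log 4 + |Real.log u|)
  have hlog : MeasureTheory.IntegrableOn (fun u : ℝ ↦ Real.log 4 + |Real.log u|) (Icc (-2) 2) := by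
    refine MeasureTheory.Integrable.add (MeasureTheory.integrable_const _) ?_
    refine MeasureTheory.Integrable.abs ?_
    exact (intervalIntegrable_iff_integrableOn_Icc_of_le (by norm_num)).1
      intervalIntegral.intervalIntegrable_log'
  have hfin : ∫⁻ u in Icc (-2 : ℝ) 2, φ u < ⊤ := hlog.lintegral_lt_top
  refine ⟨(∫⁻ u in Icc (-2 : ℝ) 2, φ u).toNNReal, fun γ hγ hlow a ↦ ?_⟩
  rw [ENNReal.coe_toNNReal hfin.ne]
  -- With $\gamma(t_0)$ nearest to $a$, $|\gamma(t)-\gamma(t_0)|\le 2|\gamma(t)-a|$. Hence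
  -- $|t-t_0|/4$ replaces $|\gamma(t)-a|$, and translation removes $t_0$.
  obtain ⟨t₀, ht₀, hmin⟩ := (isCompact_Icc (a := (-1 : ℝ)) (b := 1)).exists_isMinOn
    (nonempty_Icc.2 (by norm_num)) (f := fun t ↦ ‖γ t - a‖) (by fun_prop)
  have hpt : ∀ t ∈ Icc (-1 : ℝ) 1, t ≠ t₀ →
      ENNReal.ofReal (Real.posLog ‖(γ t - a)⁻¹‖) ≤ φ (t - t₀) := by
    intro t ht hne
    have hpos : 0 < |t - t₀| := abs_pos.2 (sub_ne_zero.2 hne)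
    have h1 : |t - t₀| / 4 ≤ ‖γ t - a‖ := by
      have h2 := hlow t ht t₀ ht₀
      have h3 : ‖γ t₀ - a‖ ≤ ‖γ t - a‖ := hmin ht
      have h4 : ‖γ t - γ t₀‖ ≤ ‖γ t - a‖ + ‖γ t₀ - a‖ := by
        have := norm_sub_le (γ t - a) (γ t₀ - a)
        rwa [sub_sub_sub_cancel_right] at this
      linarith
    refine ENNReal.ofReal_le_ofReal ?_
    have h5 : ‖(γ t - a)⁻¹‖ ≤ 4 * |t - t₀|⁻¹ := by
      rw [norm_inv, ← div_eq_mul_inv, ← inv_div]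
      exact inv_anti₀ (by positivity) h1
    refine (Real.posLog_le_posLog (norm_nonneg _) h5).trans (Real.posLog_mul.trans ?_)
    gcongr
    · rw [Real.posLog_eq_log (by norm_num)]
    · rw [Real.posLog_apply, Real.log_inv, Real.log_abs]
      exact max_le (abs_nonneg _) (neg_le_abs _)
  calc ∫⁻ t in Icc (-1 : ℝ) 1, ENNReal.ofReal (Real.posLog ‖(γ t - a)⁻¹‖)
      ≤ ∫⁻ t in Icc (-1 : ℝ) 1, φ (t - t₀) := by
        refine MeasureTheory.lintegral_mono_ae ?_
        filter_upwards [MeasureTheory.ae_restrict_mem measurableSet_Icc,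
          (countable_singleton t₀).ae_notMem _] with t ht hne
        exact hpt t ht hne
    _ = ∫⁻ t, (Icc (-1 : ℝ) 1).indicator (fun t ↦ φ (t - t₀)) t :=
        (MeasureTheory.lintegral_indicator measurableSet_Icc _).symm
    _ ≤ ∫⁻ t, (Icc (-2 : ℝ) 2).indicator φ (t - t₀) := by
        refine MeasureTheory.lintegral_mono fun t ↦ ?_
        by_cases ht : t ∈ Icc (-1 : ℝ) 1
        · rw [indicator_of_mem ht, indicator_of_mem]
          constructor <;> linarith [ht.1, ht.2, ht₀.1, ht₀.2]
        · rw [indicator_of_notMem ht]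
          positivity
    _ = ∫⁻ t, (Icc (-2 : ℝ) 2).indicator φ t :=
        MeasureTheory.lintegral_sub_right_eq_self _ t₀
    _ = ∫⁻ u in Icc (-2 : ℝ) 2, φ u := MeasureTheory.lintegral_indicator measurableSet_Icc _

/-- Since $\log^+$ is subadditive on products, only the number of factors counts, not their zeros.
-/
theorem lintegral_posLog_inv_prod_le {C : NNReal} {γ : ℝ → ℂ} (hγ : Continuous γ)
    (hC : ∀ a : ℂ, ∫⁻ t in Icc (-1 : ℝ) 1, ENNReal.ofReal (Real.posLog ‖(γ t - a)⁻¹‖) ≤ C)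
    (s : Multiset ℂ) :
    ∫⁻ t in Icc (-1 : ℝ) 1, ENNReal.ofReal (Real.posLog ‖((s.map (γ t - ·)).prod)⁻¹‖) ≤
      s.card * C := by
  induction s using Multiset.induction_on with
  | empty => simp
  | cons a s ih =>
    have hmeas : Measurable fun t ↦ ENNReal.ofReal (Real.posLog ‖(γ t - a)⁻¹‖) := by
      unfold Real.posLog
      fun_prop
    calc ∫⁻ t in Icc (-1 : ℝ) 1,
          ENNReal.ofReal (Real.posLog ‖(((a ::ₘ s).map (γ t - ·)).prod)⁻¹‖)
        ≤ ∫⁻ t in Icc (-1 : ℝ) 1, (ENNReal.ofReal (Real.posLog ‖(γ t - a)⁻¹‖) +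
            ENNReal.ofReal (Real.posLog ‖((s.map (γ t - ·)).prod)⁻¹‖)) := by
          refine MeasureTheory.lintegral_mono fun t ↦ ?_
          rw [← ENNReal.ofReal_add Real.posLog_nonneg Real.posLog_nonneg]
          refine ENNReal.ofReal_le_ofReal ?_
          rw [Multiset.map_cons, Multiset.prod_cons, mul_inv, norm_mul]
          exact Real.posLog_mul
      _ ≤ C + s.card * C := by
          rw [MeasureTheory.lintegral_add_left hmeas]
          exact add_le_add (hC a) ih
      _ = (a ::ₘ s).card * C := by
          rw [Multiset.card_cons]; push_cast; ring

/-- Uniform factorization of `F n * u n - w n` for a uniformly convergent sequence `F n`. -/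
theorem exists_norm_inv_le_of_tendstoUniformlyOn {F : ℕ → ℂ → ℂ} {G : ℂ → ℂ} {ρ : ℝ} (hρ : 0 < ρ)
    (hF : ∀ᶠ n in atTop, DifferentiableOn ℂ (F n) (Metric.ball 0 ρ))
    (hG : DifferentiableOn ℂ G (Metric.ball 0 ρ))
    (hFG : TendstoUniformlyOn F G atTop (Metric.ball 0 ρ))
    (hnc : ∀ b, ¬ ∀ᶠ z in 𝓝 (0 : ℂ), G z = b) {u w : ℕ → ℂ} {u₀ w₀ : ℂ}
    (hu : Tendsto u atTop (𝓝 u₀)) (hw : Tendsto w atTop (𝓝 w₀)) (hu₁ : ∀ n, ‖u n‖ ≤ 1)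
    (hne : u₀ ≠ 0 ∨ w₀ ≠ 0) :
    ∃ r > 0, r ≤ ρ ∧ ∃ (k : ℕ) (A : ℝ), ∀ᶠ n in atTop, ∃ s : Multiset ℂ, s.card = k ∧
      ∀ z ∈ Metric.ball (0 : ℂ) r, ‖F n z‖ ≤ A ∧
        ‖(F n z * u n - w n)⁻¹‖ ≤ A * ‖((s.map (z - ·)).prod)⁻¹‖ := by
  have hρ2 : Metric.ball (0 : ℂ) (ρ / 2) ⊆ Metric.ball 0 ρ :=
    Metric.ball_subset_ball (half_le_self hρ.le)
  obtain ⟨M, hM⟩ := (isCompact_closedBall (0 : ℂ) (ρ / 2)).exists_bound_of_continuousOn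
    (hG.continuousOn.mono (Metric.closedBall_subset_ball (half_lt_self hρ)))
  have hM0 : 0 ≤ M := (norm_nonneg _).trans (hM 0 (Metric.mem_closedBall_self (by positivity)))
  have hGd : DifferentiableOn ℂ (fun z ↦ G z * u₀ - w₀) (Metric.ball 0 (ρ / 2)) :=
    ((hG.mono hρ2).mul_const _).sub_const _
  -- If $u_0=0$ the function is the nonzero constant $-w_0$; otherwise its vanishing would make $G$
  -- constant.
  have hord : analyticOrderAt (fun z ↦ G z * u₀ - w₀) 0 ≠ ⊤ := by
    rw [ne_eq, analyticOrderAt_eq_top]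
    intro h
    by_cases hu0 : u₀ = 0
    · have := h.self_of_nhds
      simp only [hu0, mul_zero, zero_sub, neg_eq_zero] at this
      simp [hu0, this] at hne
    · refine hnc (w₀ / u₀) ?_
      filter_upwards [h] with z hz
      rw [eq_div_iff hu0]
      exact sub_eq_zero.1 hz
  obtain ⟨k, hk⟩ := ENat.ne_top_iff_exists.1 hord
  obtain ⟨r, hr, hrρ, c, hc, ε, hε, hfac⟩ :=
    exists_factorization_of_near k (half_pos hρ) hGd hk.symm
  refine ⟨r, hr, by linarith, k, max (M + 1) c⁻¹, ?_⟩
  rw [Metric.tendstoUniformlyOn_iff] at hFG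
  have hu' := (Metric.tendsto_nhds.1 hu) (ε / (3 * (M + 1))) (by positivity)
  have hw' := (Metric.tendsto_nhds.1 hw) (ε / 3) (by positivity)
  filter_upwards [hF, hFG 1 one_pos, hFG (ε / 3) (by positivity), hu', hw']
    with n hFn h1 h2 h3 h4
  have hclose : ∀ z ∈ Metric.ball (0 : ℂ) (ρ / 2),
      ‖(F n z * u n - w n) - (G z * u₀ - w₀)‖ < ε := by
    intro z hz
    have e : (F n z * u n - w n) - (G z * u₀ - w₀) =
        (F n z - G z) * u n + G z * (u n - u₀) - (w n - w₀) := by ring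
    rw [e]
    refine (norm_sub_le _ _).trans_lt ?_
    have h5 := norm_add_le ((F n z - G z) * u n) (G z * (u n - u₀))
    rw [norm_mul, norm_mul] at h5
    have h6 := h2 z (hρ2 hz)
    rw [dist_comm, dist_eq_norm] at h6
    rw [dist_eq_norm] at h3 h4
    have h7 : ‖F n z - G z‖ * ‖u n‖ ≤ ε / 3 :=
      (mul_le_of_le_one_right (norm_nonneg _) (hu₁ n)).trans h6.le
    have h8 : ‖G z‖ * ‖u n - u₀‖ ≤ ε / 3 := by
      have h9 := hM z (Metric.ball_subset_closedBall hz)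
      calc ‖G z‖ * ‖u n - u₀‖ ≤ (M + 1) * (ε / (3 * (M + 1))) := by gcongr; linarith
        _ = ε / 3 := by field_simp
    linarith
  obtain ⟨s, hs, K, hK⟩ := hfac (fun z ↦ F n z * u n - w n)
    (((hFn.mono hρ2).mul_const _).sub_const _) hclose
  refine ⟨s, hs, fun z hz ↦ ⟨?_, ?_⟩⟩
  · have hz2 : z ∈ Metric.ball (0 : ℂ) (ρ / 2) := Metric.ball_subset_ball hrρ hz
    have h5 := h1 z (hρ2 hz2)
    rw [dist_comm, dist_eq_norm] at h5
    have h6 := hM z (Metric.ball_subset_closedBall hz2)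
    have h7 := norm_sub_norm_le (F n z) (G z)
    exact le_trans (by linarith) (le_max_left _ _)
  · obtain ⟨h5, h6⟩ := hK z hz
    rw [h5, mul_inv, norm_mul, mul_comm, norm_inv (K z)]
    gcongr
    exact (inv_anti₀ hc h6).trans (le_max_right _ _)

/-- For a spherically convergent sequence with nonconstant limit, the functions `1 / (f n - c n)`
are bounded by boundedly many polar factors near `z₀ = 0`, whatever the numbers `c n` do. -/
theorem SphericallyConvergesOn.exists_norm_inv_sub_le {f : ℕ → ℂ → ℂ} {g : ℂ → OnePoint ℂ}
    {U : Set ℂ} (hf : ∀ n, Meromorphic (f n)) (htop : ∀ n z, meromorphicOrderAt (f n) z ≠ ⊤)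
    (hU : IsOpen U) (hUc : IsPreconnected U) (h0 : 0 ∈ U)
    (hg : SphericallyConvergesOn (fun n ↦ toSphere (f n)) g U)
    (hnc : ¬ ∃ a : OnePoint ℂ, ∀ z ∈ U, g z = a) {c : ℕ → ℂ} {x y : ℂ}
    (hx : Tendsto (fun n ↦ sphereNum (c n)) atTop (𝓝 x))
    (hy : Tendsto (fun n ↦ sphereDen (c n)) atTop (𝓝 y)) :
    ∃ r > 0, ∃ (k : ℕ) (A : ℝ), ∀ᶠ n in atTop, ∃ s : Multiset ℂ, s.card = k ∧
      ∀ z ∈ Metric.ball (0 : ℂ) r, AnalyticAt ℂ (f n) z →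
        ‖(f n z - c n)⁻¹‖ ≤ A * ‖((s.map (z - ·)).prod)⁻¹‖ := by
  have hxy : ‖x‖ ^ 2 + ‖y‖ ^ 2 = 1 := tendsto_nhds_unique
    ((hx.norm.pow 2).add (hy.norm.pow 2))
    (by simp only [norm_sphereNum_sq_add_norm_sphereDen_sq]; exact tendsto_const_nhds)
  have hne : x ≠ 0 ∨ y ≠ 0 := by
    by_contra! h
    simp [h.1, h.2] at hxy
  have hnum : ∀ n, ‖sphereNum (c n)‖ ≤ 1 := fun n ↦ by
    nlinarith [norm_sphereNum_sq_add_norm_sphereDen_sq (c n), norm_nonneg (sphereNum (c n)),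
      sq_nonneg ‖sphereDen (c n)‖]
  have hden : ∀ n, ‖sphereDen (c n)‖ ≤ 1 := fun n ↦ by
    nlinarith [norm_sphereNum_sq_add_norm_sphereDen_sq (c n), norm_nonneg (sphereDen (c n)),
      sq_nonneg ‖sphereNum (c n)‖]
  have hden0 : ∀ n, sphereDen (c n) ≠ 0 := fun n ↦ by
    rw [sphereDen_coe]
    exact one_div_ne_zero (by exact_mod_cast (Real.sqrt_pos.2 (by positivity)).ne')
  have hnd : ∀ n, sphereNum (c n) = c n * sphereDen (c n) := fun n ↦ by
    rw [sphereNum_coe, sphereDen_coe, mul_one_div]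
  by_cases hfin : g 0 = OnePoint.infty
  · obtain ⟨ρ, hρ, -, G, hG, hgG, hFn, hFG⟩ := exists_uniform_limit_of_ne_infty
      (fun n z ↦ (hf n z).inv) (fun n z ↦ by
        rw [meromorphicOrderAt_inv, ne_eq, LinearOrderedAddCommGroupWithTop.neg_eq_top]
        exact htop n z) hU (hg.toSphere_inv hf htop) h0 (by
        rw [hfin, sphereInv_infty]; exact OnePoint.coe_ne_infty 0)
    have hGnc : ∀ b, ¬ ∀ᶠ z in 𝓝 (0 : ℂ), G z = b := by
      intro b hb
      refine hnc ⟨_root_.sphereInv b, hg.eqOn_const hf htop hU hUc h0 ?_⟩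
      filter_upwards [hb, Metric.ball_mem_nhds 0 hρ] with z hz hzρ
      rw [← hz, ← hgG z hzρ, sphereInv_sphereInv]
    obtain ⟨r, hr, hrρ, k, A, hA⟩ := exists_norm_inv_le_of_tendstoUniformlyOn hρ
      (hFn.mono fun n h ↦ h.1) hG hFG hGnc hx hy hnum hne
    refine ⟨r, hr, k, A * A, ?_⟩
    filter_upwards [hA, hFn] with n ⟨s, hs, hsA⟩ hn
    refine ⟨s, hs, fun z hz han ↦ ?_⟩
    obtain ⟨h1, h2⟩ := hsA z hz
    have h3 := hn.2 z (Metric.ball_subset_ball hrρ hz)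
    rw [_root_.toSphere_inv (hf n z) (htop n z), toSphere_of_analyticAt han, sphereInv_coe] at h3
    have hfz : f n z ≠ 0 := by
      intro h
      rw [if_pos h] at h3
      exact OnePoint.infty_ne_coe _ h3
    rw [if_neg hfz, OnePoint.coe_eq_coe] at h3
    rw [← h3] at h1 h2
    -- At a pole of the limit one works with $1/f_n$, and the roles of the coordinates of $c_n$ are
    -- exchanged. The extra factor $1/f_n$ is bounded by $A$, hence the constant $A^2$.
    have e : (f n z - c n)⁻¹ = -((f n z)⁻¹ * sphereDen (c n) *
        ((f n z)⁻¹ * sphereNum (c n) - sphereDen (c n))⁻¹) := by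
      have e1 : (f n z)⁻¹ * sphereNum (c n) - sphereDen (c n) =
          -((f n z)⁻¹ * sphereDen (c n) * (f n z - c n)) := by
        rw [hnd]; field_simp; ring
      rw [e1, inv_neg, mul_inv, mul_neg, neg_neg, mul_inv_cancel_left₀]
      exact mul_ne_zero (inv_ne_zero hfz) (hden0 n)
    rw [e, norm_neg, norm_mul, norm_mul, mul_assoc A A]
    have hA0 : 0 ≤ A := (norm_nonneg _).trans h1
    refine mul_le_mul ?_ h2 (norm_nonneg _) hA0
    exact (mul_le_of_le_one_right (norm_nonneg _) (hden n)).trans h1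
  · obtain ⟨ρ, hρ, -, G, hG, hgG, hFn, hFG⟩ :=
      exists_uniform_limit_of_ne_infty hf htop hU hg h0 hfin
    have hGnc : ∀ b, ¬ ∀ᶠ z in 𝓝 (0 : ℂ), G z = b := by
      intro b hb
      refine hnc ⟨b, hg.eqOn_const hf htop hU hUc h0 ?_⟩
      filter_upwards [hb, Metric.ball_mem_nhds 0 hρ] with z hz hzρ
      rw [← hz, ← hgG z hzρ]
    obtain ⟨r, hr, hrρ, k, A, hA⟩ := exists_norm_inv_le_of_tendstoUniformlyOn hρ
      (hFn.mono fun n h ↦ h.1) hG hFG hGnc hy hx hden hne.symm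
    refine ⟨r, hr, k, A, ?_⟩
    filter_upwards [hA, hFn] with n ⟨s, hs, hsA⟩ hn
    refine ⟨s, hs, fun z hz han ↦ ?_⟩
    obtain ⟨-, h2⟩ := hsA z hz
    have h3 := hn.2 z (Metric.ball_subset_ball hrρ hz)
    rw [toSphere_of_analyticAt han, OnePoint.coe_eq_coe] at h3
    rw [← h3] at h2
    have e : (f n z - c n)⁻¹ =
        sphereDen (c n) * (f n z * sphereDen (c n) - sphereNum (c n))⁻¹ := by
      rw [hnd, ← sub_mul, mul_comm (f n z - c n), mul_inv, mul_inv_cancel_left₀ (hden0 n)]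
    rw [e, norm_mul]
    exact (mul_le_of_le_one_left (norm_nonneg _) (hden n)).trans h2

end

/-! ### Rescaled arcs and the bound on a single arc. -/

noncomputable section

/-- Infinite order at one point spreads over the connected plane and makes $f$ the rational function
$0$; this is where transcendence enters. -/
theorem IsGeneralisedYosida.meromorphicOrderAt_ne_top {α β : ℝ} {f : ℂ → ℂ}
    (hf : IsGeneralisedYosida α β f) (z : ℂ) : meromorphicOrderAt f z ≠ ⊤ := by
  intro hz
  have hall : ∀ w, meromorphicOrderAt f w = ⊤ := by
    by_contra! hw
    obtain ⟨w, hw⟩ := hw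
    exact (MeromorphicOn.exists_meromorphicOrderAt_ne_top_iff_forall
      (fun z _ ↦ hf.meromorphic z) isConnected_univ).1 ⟨⟨w, mem_univ w⟩, hw⟩ ⟨z, mem_univ z⟩ hz
  refine hf.transcendental ⟨0, 1, one_ne_zero, ?_⟩
  rw [EventuallyEq, Filter.Eventually, mem_codiscrete]
  intro w
  rw [disjoint_principal_right, compl_compl]
  filter_upwards [meromorphicOrderAt_eq_top_iff.1 (hall w)] with v hv
  simp [hv]

theorem analyticAt_yosidaRescale {α β : ℝ} {f : ℂ → ℂ} {h z : ℂ}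
    (hf : AnalyticAt ℂ f (h + h ^ (-(β : ℂ)) * z)) :
    AnalyticAt ℂ (yosidaRescale α β f h) z := by
  have : AnalyticAt ℂ (fun z ↦ h + h ^ (-(β : ℂ)) * z) z := by fun_prop
  exact analyticAt_const.mul (hf.comp (f := fun z ↦ h + h ^ (-(β : ℂ)) * z) this)

theorem tendsto_nhdsNE_affine (a : ℂ) {b : ℂ} (hb : b ≠ 0) (z : ℂ) :
    Tendsto (fun z ↦ a + b * z) (𝓝[≠] z) (𝓝[≠] (a + b * z)) := by
  refine tendsto_nhdsWithin_iff.2 ⟨?_, ?_⟩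
  · exact (Continuous.tendsto (by fun_prop) z).mono_left nhdsWithin_le_nhds
  · filter_upwards [self_mem_nhdsWithin] with w hw
    simpa [hb] using hw

theorem meromorphic_yosidaRescale {α β : ℝ} {f : ℂ → ℂ} (hf : Meromorphic f) (h : ℂ) :
    Meromorphic (yosidaRescale α β f h) := by
  intro z
  have : AnalyticAt ℂ (fun z ↦ h + h ^ (-(β : ℂ)) * z) z := by fun_prop
  exact (MeromorphicAt.const _ z).mul
    ((hf (h + h ^ (-(β : ℂ)) * z)).comp_analyticAt (g := fun z ↦ h + h ^ (-(β : ℂ)) * z) this)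

theorem meromorphicOrderAt_yosidaRescale_ne_top {α β : ℝ} {f : ℂ → ℂ} (hf : Meromorphic f)
    (htop : ∀ z, meromorphicOrderAt f z ≠ ⊤) {h : ℂ} (hh : h ≠ 0) (z : ℂ) :
    meromorphicOrderAt (yosidaRescale α β f h) z ≠ ⊤ := by
  rw [meromorphicOrderAt_ne_top_iff_eventually_ne_zero (meromorphic_yosidaRescale hf h z)]
  have h1 := (meromorphicOrderAt_ne_top_iff_eventually_ne_zero (hf _)).1
    (htop (h + h ^ (-(β : ℂ)) * z))
  have h2 : h ^ (-(β : ℂ)) ≠ 0 := by simp [Complex.cpow_eq_zero_iff, hh]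
  filter_upwards [(tendsto_nhdsNE_affine h h2 z).eventually h1] with w hw
  exact mul_ne_zero (by simp [Complex.cpow_eq_zero_iff, hh]) hw

theorem norm_cpow_ofReal {h : ℂ} (hh : h ≠ 0) (a : ℝ) : ‖h ^ (a : ℂ)‖ = ‖h‖ ^ a := by
  rw [Complex.norm_cpow_of_ne_zero hh]
  simp

/-- In the coordinate of `yosidaRescale α β f h`, an arc through `h` of the circle around `0`,
parametrised with speed one. -/
def arcCurve (β : ℝ) (h : ℂ) (t : ℝ) : ℂ :=
  h * h ^ (β : ℂ) * (Complex.exp (Complex.I * (‖h‖ ^ (-(1 + β)) * t : ℝ)) - 1)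

theorem continuous_arcCurve (β : ℝ) (h : ℂ) : Continuous (arcCurve β h) := by
  unfold arcCurve
  fun_prop

theorem add_mul_arcCurve {β : ℝ} {h : ℂ} (hh : h ≠ 0) (t : ℝ) :
    h + h ^ (-(β : ℂ)) * arcCurve β h t =
      h * Complex.exp (Complex.I * (‖h‖ ^ (-(1 + β)) * t : ℝ)) := by
  have h1 : h ^ (β : ℂ) ≠ 0 := by simp [Complex.cpow_eq_zero_iff, hh]
  rw [arcCurve, Complex.cpow_neg]
  field_simp
  ring

theorem norm_arcCurve_sub {β : ℝ} {h : ℂ} (hh : h ≠ 0) (t t' : ℝ) :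
    ‖arcCurve β h t - arcCurve β h t'‖ =
      ‖h‖ ^ (1 + β) * (2 * |Real.sin (‖h‖ ^ (-(1 + β)) * (t - t') / 2)|) := by
  set s := ‖h‖ ^ (-(1 + β)) with hs
  have e : arcCurve β h t - arcCurve β h t' = h * h ^ (β : ℂ) *
      (Complex.exp (Complex.I * (s * t' : ℝ)) *
        (Complex.exp (Complex.I * (s * (t - t') : ℝ)) - 1)) := by
    rw [mul_sub, ← Complex.exp_add, arcCurve, arcCurve, ← hs]
    have : Complex.I * (s * t' : ℝ) + Complex.I * (s * (t - t') : ℝ) =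
        Complex.I * (s * t : ℝ) := by push_cast; ring
    rw [this]
    ring
  rw [e, norm_mul, norm_mul, norm_mul, Complex.norm_exp_I_mul_ofReal, one_mul,
    Complex.norm_exp_I_mul_ofReal_sub_one, norm_cpow_ofReal hh,
    Real.rpow_add (norm_pos_iff.2 hh), Real.rpow_one, norm_mul, Real.norm_eq_abs, Real.norm_eq_abs,
    abs_two]

theorem arcSpeed_mul {β : ℝ} {h : ℂ} (hh : h ≠ 0) : ‖h‖ ^ (1 + β) * ‖h‖ ^ (-(1 + β)) = 1 := by
  rw [← Real.rpow_add (norm_pos_iff.2 hh)]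
  simp

theorem arcSpeed_le_one {β : ℝ} (hβ : -1 ≤ β) {h : ℂ} (hh : 1 ≤ ‖h‖) :
    ‖h‖ ^ (-(1 + β)) ≤ 1 := Real.rpow_le_one_of_one_le_of_nonpos hh (by linarith)

theorem norm_arcCurve_le {β : ℝ} {h : ℂ} (hh : h ≠ 0) (t : ℝ) : ‖arcCurve β h t‖ ≤ |t| := by
  have h0 : arcCurve β h 0 = 0 := by simp [arcCurve]
  have h1 := norm_arcCurve_sub (β := β) hh t 0
  rw [h0, sub_zero, sub_zero] at h1
  have hs : 0 ≤ ‖h‖ ^ (-(1 + β)) := by positivity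
  rw [h1]
  calc ‖h‖ ^ (1 + β) * (2 * |Real.sin (‖h‖ ^ (-(1 + β)) * t / 2)|)
      ≤ ‖h‖ ^ (1 + β) * (2 * |‖h‖ ^ (-(1 + β)) * t / 2|) := by
        gcongr ‖h‖ ^ (1 + β) * (2 * ?_)
        exact Real.abs_sin_le_abs
    _ = ‖h‖ ^ (1 + β) * ‖h‖ ^ (-(1 + β)) * |t| := by
        rw [abs_div, abs_mul, abs_of_nonneg hs, abs_two]; ring
    _ = |t| := by rw [arcSpeed_mul hh, one_mul]

/-- The half-angle $|h|^{-(1+\beta)}|t-t'|/2$ is at most $1\le\pi/2$ because $\beta\ge-1$, so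
Jordan's inequality applies and gives the constant $2/\pi\ge1/2$. -/
theorem le_norm_arcCurve_sub {β : ℝ} (hβ : -1 ≤ β) {h : ℂ} (hh : 1 ≤ ‖h‖) {t t' : ℝ}
    (ht : t ∈ Icc (-1 : ℝ) 1) (ht' : t' ∈ Icc (-1 : ℝ) 1) :
    |t - t'| / 2 ≤ ‖arcCurve β h t - arcCurve β h t'‖ := by
  have hh0 : h ≠ 0 := norm_pos_iff.1 (by linarith)
  have hs : 0 ≤ ‖h‖ ^ (-(1 + β)) := by positivity
  have hs1 := arcSpeed_le_one hβ hh
  have ht2 : |t - t'| ≤ 2 := by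
    rw [abs_le]; constructor <;> linarith [ht.1, ht.2, ht'.1, ht'.2]
  have habs : |‖h‖ ^ (-(1 + β)) * (t - t') / 2| = ‖h‖ ^ (-(1 + β)) * |t - t'| / 2 := by
    rw [abs_div, abs_mul, abs_of_nonneg hs, abs_two]
  rw [norm_arcCurve_sub hh0]
  have h1 := Real.mul_abs_le_abs_sin (x := ‖h‖ ^ (-(1 + β)) * (t - t') / 2) (by
    rw [habs]
    have : ‖h‖ ^ (-(1 + β)) * |t - t'| ≤ 1 * 2 := mul_le_mul hs1 ht2 (abs_nonneg _) zero_le_one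
    linarith [Real.two_le_pi])
  calc |t - t'| / 2 ≤ 2 / Real.pi * |t - t'| := by
        have : 1 / 2 ≤ 2 / Real.pi := by
          rw [div_le_div_iff₀ (by norm_num) Real.pi_pos]; linarith [Real.pi_le_four]
        nlinarith [abs_nonneg (t - t')]
    _ = ‖h‖ ^ (1 + β) * (2 * (2 / Real.pi * |‖h‖ ^ (-(1 + β)) * (t - t') / 2|)) := by
        rw [habs]
        linear_combination (-(2 / Real.pi * |t - t'|)) * arcSpeed_mul (β := β) hh0
    _ ≤ _ := by gcongr

theorem isOpen_yosidaDomain (β : ℝ) : IsOpen (yosidaDomain β) := by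
  by_cases h : β = -1
  · have : yosidaDomain β = {-1}ᶜ := by ext; simp [yosidaDomain, h]
    rw [this]
    exact isOpen_compl_singleton
  · have : yosidaDomain β = univ := by ext; simp [yosidaDomain, h]
    rw [this]
    exact isOpen_univ

theorem isPreconnected_yosidaDomain (β : ℝ) : IsPreconnected (yosidaDomain β) := by
  by_cases h : β = -1
  · have : yosidaDomain β = {-1}ᶜ := by ext; simp [yosidaDomain, h]
    rw [this]
    exact (isConnected_compl_singleton_of_one_lt_rank
      (by rw [Complex.rank_real_complex]; norm_num) _).isPreconnected
  · have : yosidaDomain β = univ := by ext; simp [yosidaDomain, h]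
    rw [this]
    exact isPreconnected_univ

theorem zero_mem_yosidaDomain (β : ℝ) : 0 ∈ yosidaDomain β := by simp [yosidaDomain]

theorem SphericallyConvergesOn.comp_strictMono {F : ℕ → ℂ → OnePoint ℂ} {g : ℂ → OnePoint ℂ}
    {U : Set ℂ} (h : SphericallyConvergesOn F g U) {φ : ℕ → ℕ} (hφ : StrictMono φ) :
    SphericallyConvergesOn (fun n ↦ F (φ n)) g U := fun K hKU hK ε hε ↦
  hφ.tendsto_atTop.eventually (h K hKU hK ε hε)

/-- Applied to $h_n^{-\alpha}c$; unit coordinates cover bounded and unbounded behaviour at once, so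
no distinction by the sign of $\alpha$ is needed. -/
theorem exists_subseq_tendsto_sphere (p : ℕ → OnePoint ℂ) : ∃ φ : ℕ → ℕ, StrictMono φ ∧
    ∃ x y : ℂ, Tendsto (fun n ↦ sphereNum (p (φ n))) atTop (𝓝 x) ∧
      Tendsto (fun n ↦ sphereDen (p (φ n))) atTop (𝓝 y) := by
  have hmem : ∀ n, (sphereNum (p n), sphereDen (p n)) ∈ Metric.closedBall (0 : ℂ × ℂ) 1 := by
    intro n
    have h := norm_sphereNum_sq_add_norm_sphereDen_sq (p n)
    rw [mem_closedBall_zero_iff, Prod.norm_def]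
    refine max_le ?_ ?_ <;>
    nlinarith [sq_nonneg ‖sphereNum (p n)‖, sq_nonneg ‖sphereDen (p n)‖,
      norm_nonneg (sphereNum (p n)), norm_nonneg (sphereDen (p n))]
  obtain ⟨⟨x, y⟩, -, φ, hφ, hlim⟩ := (isCompact_closedBall (0 : ℂ × ℂ) 1).tendsto_subseq hmem
  exact ⟨φ, hφ, x, y, (continuous_fst.tendsto _).comp hlim, (continuous_snd.tendsto _).comp hlim⟩

/-- Along a sequence tending to `∞`, a subsequence of `1 / (f - c)` is bounded on shrinking arcs
by boundedly many polar factors. -/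
theorem IsGeneralisedYosida.exists_subseq_norm_inv_sub_le {α β : ℝ} {f : ℂ → ℂ}
    (hf : IsGeneralisedYosida α β f) (c : ℂ) {h : ℕ → ℂ} (hh : ∀ n, 1 ≤ ‖h n‖)
    (hlim : Tendsto (fun n ↦ ‖h n‖) atTop atTop) :
    ∃ φ : ℕ → ℕ, StrictMono φ ∧ ∃ r > 0, ∃ (k : ℕ) (A : ℝ), ∀ᶠ n in atTop, ∃ s : Multiset ℂ,
      s.card = k ∧ ∀ z ∈ Metric.ball (0 : ℂ) r,
        AnalyticAt ℂ f (h (φ n) + h (φ n) ^ (-(β : ℂ)) * z) →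
        ‖1 / (f (h (φ n) + h (φ n) ^ (-(β : ℂ)) * z) - c)‖ ≤
          ‖h (φ n)‖ ^ (-α) * (A * ‖((s.map (z - ·)).prod)⁻¹‖) := by
  have hh0 : ∀ n, h n ≠ 0 := fun n ↦ norm_pos_iff.1 (by linarith [hh n])
  obtain ⟨φ, hφ, g, hg⟩ := hf.normal (fun n ↦ toSphere (yosidaRescale α β f (h n)))
    fun n ↦ ⟨h n, hh n, rfl⟩
  have hnc := hf.limit_nonconstant (fun n ↦ h (φ n)) g (fun n ↦ hh _)
    (hlim.comp hφ.tendsto_atTop) hg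
  obtain ⟨ψ, hψ, x, y, hx, hy⟩ :=
    exists_subseq_tendsto_sphere fun n ↦ ((h (φ n) ^ (-(α : ℂ)) * c : ℂ) : OnePoint ℂ)
  obtain ⟨r, hr, k, A, hA⟩ := SphericallyConvergesOn.exists_norm_inv_sub_le
    (f := fun n ↦ yosidaRescale α β f (h (φ (ψ n))))
    (fun n ↦ meromorphic_yosidaRescale hf.meromorphic _)
    (fun n ↦ meromorphicOrderAt_yosidaRescale_ne_top hf.meromorphic hf.meromorphicOrderAt_ne_top
      (hh0 _)) (isOpen_yosidaDomain β) (isPreconnected_yosidaDomain β) (zero_mem_yosidaDomain β)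
    (hg.comp_strictMono hψ) hnc hx hy
  refine ⟨fun n ↦ φ (ψ n), hφ.comp hψ, r, hr, k, A, ?_⟩
  filter_upwards [hA] with n ⟨s, hs, hsA⟩
  refine ⟨s, hs, fun z hz han ↦ ?_⟩
  have h1 := hsA z hz (analyticAt_yosidaRescale han)
  have h2 : h (φ (ψ n)) ^ (-(α : ℂ)) ≠ 0 := by simp [Complex.cpow_eq_zero_iff, hh0]
  have h3 : ‖h (φ (ψ n)) ^ (-(α : ℂ))‖ = ‖h (φ (ψ n))‖ ^ (-α) := by
    have := norm_cpow_ofReal (hh0 (φ (ψ n))) (-α)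
    rwa [Complex.ofReal_neg] at this
  have e : 1 / (f (h (φ (ψ n)) + h (φ (ψ n)) ^ (-(β : ℂ)) * z) - c) = h (φ (ψ n)) ^ (-(α : ℂ)) *
      (yosidaRescale α β f (h (φ (ψ n))) z - h (φ (ψ n)) ^ (-(α : ℂ)) * c)⁻¹ := by
    rw [yosidaRescale, ← mul_sub, mul_inv, mul_inv_cancel_left₀ h2, one_div]
  rw [e, norm_mul, h3]
  gcongr

/-- Almost every point of an arc is a point of analyticity. -/
theorem ae_analyticAt_arcCurve {β : ℝ} (hβ : -1 ≤ β) {f : ℂ → ℂ} (hf : Meromorphic f) {h : ℂ}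
    (hh : 1 ≤ ‖h‖) : ∀ᵐ t : ℝ, t ∈ Icc (-1 : ℝ) 1 →
      AnalyticAt ℂ f (h + h ^ (-(β : ℂ)) * arcCurve β h t) := by
  have hh0 : h ≠ 0 := norm_pos_iff.1 (by linarith)
  have h2 : h ^ (-(β : ℂ)) ≠ 0 := by simp [Complex.cpow_eq_zero_iff, hh0]
  have hinj : InjOn (fun t : ℝ ↦ h + h ^ (-(β : ℂ)) * arcCurve β h t) (Icc (-1) 1) := by
    intro t ht t' ht' heq
    have heq' : arcCurve β h t = arcCurve β h t' := by simpa [h2] using heq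
    have := le_norm_arcCurve_sub hβ hh ht ht'
    rw [heq', sub_self, norm_zero] at this
    have h3 := abs_nonneg (t - t')
    exact sub_eq_zero.1 (abs_eq_zero.1 (by linarith))
  have hc : ({t ∈ Icc (-1 : ℝ) 1 | h + h ^ (-(β : ℂ)) * arcCurve β h t ∈
      {z | AnalyticAt ℂ f z}ᶜ}).Countable := by
    refine MapsTo.countable_of_injOn (f := fun t : ℝ ↦ h + h ^ (-(β : ℂ)) * arcCurve β h t)
      (fun t ht ↦ ht.2) (hinj.mono fun t ht ↦ ht.1) hf.countable_compl_analyticAt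
  filter_upwards [hc.ae_notMem _] with t ht ht1
  by_contra hcon
  exact ht ⟨ht1, hcon⟩

/-- The contribution of an arc around `h` to the proximity function. -/
theorem IsGeneralisedYosida.exists_lintegral_arc_le {α β : ℝ} (hβ : -1 ≤ β) {f : ℂ → ℂ}
    (hf : IsGeneralisedYosida α β f) (c : ℂ) :
    ∃ σ > 0, ∃ C R : ℝ, 0 ≤ C ∧ 1 ≤ R ∧ ∀ h : ℂ, R ≤ ‖h‖ →
      ∫⁻ t in Icc (-σ) σ, ENNReal.ofReal (Real.posLog
        ‖1 / (f (h * Complex.exp (Complex.I * (‖h‖ ^ (-(1 + β)) * t : ℝ))) - c)‖) ≤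
      ENNReal.ofReal (C * (1 + Real.log ‖h‖)) := by
  -- The negation is used with $\sigma=1/(n+1)$, $C=n$, $R=n+1$, so that one sequence $h_n\to\infty$
  -- defeats all constants.
  by_contra! hcon
  have hn : ∀ n : ℕ, ∃ h : ℂ, (n + 1 : ℝ) ≤ ‖h‖ ∧
      ENNReal.ofReal (n * (1 + Real.log ‖h‖)) <
      ∫⁻ t in Icc (-(1 / (n + 1) : ℝ)) (1 / (n + 1)), ENNReal.ofReal (Real.posLog
        ‖1 / (f (h * Complex.exp (Complex.I * (‖h‖ ^ (-(1 + β)) * t : ℝ))) - c)‖) := fun n ↦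
    hcon (1 / (n + 1)) (by positivity) n (n + 1) (by positivity) (by simp)
  choose h hhn hint using hn
  have hh : ∀ n, 1 ≤ ‖h n‖ := fun n ↦ le_trans (by simp) (hhn n)
  have hlim : Tendsto (fun n ↦ ‖h n‖) atTop atTop :=
    tendsto_atTop_mono (fun n ↦ le_trans (by linarith) (hhn n)) tendsto_natCast_atTop_atTop
  obtain ⟨φ, hφ, r, hr, k, A, hA⟩ := hf.exists_subseq_norm_inv_sub_le c hh hlim
  obtain ⟨C, hC⟩ := exists_lintegral_posLog_inv_sub_le
  have hsmall : ∀ᶠ n : ℕ in atTop, (1 / ((φ n : ℕ) + 1) : ℝ) < r :=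
    (tendsto_one_div_add_atTop_nhds_zero_nat.comp hφ.tendsto_atTop).eventually_lt_const hr
  -- The factors $2$ are the length of $[-1,1]$, and $kC$ bounds the contribution of the $k$ linear
  -- factors.
  have hbig : ∀ᶠ n : ℕ in atTop, 2 * |α| + 2 * Real.posLog A + k * C + 1 ≤ (φ n : ℕ) :=
    (tendsto_natCast_atTop_atTop.comp hφ.tendsto_atTop).eventually_ge_atTop _
  obtain ⟨n, ⟨s, hs, hsA⟩, hnr, hnC⟩ := (hA.and (hsmall.and hbig)).exists
  set m := φ n
  have hm0 : h m ≠ 0 := norm_pos_iff.1 (by linarith [hh m])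
  have hlog : 0 ≤ Real.log ‖h m‖ := Real.log_nonneg (hh m)
  have hCm := lintegral_posLog_inv_prod_le (continuous_arcCurve β (h m))
    (hC _ (continuous_arcCurve β (h m)) fun t ht t' ht' ↦ le_norm_arcCurve_sub hβ (hh m) ht ht') s
  refine absurd (hint m) (not_lt.2 ?_)
  have hm1 : (1 / ((m : ℕ) + 1) : ℝ) ≤ 1 := by
    rw [div_le_one (by positivity)]; simp
  have hsub : Icc (-(1 / (m + 1) : ℝ)) (1 / (m + 1)) ⊆ Icc (-1 : ℝ) 1 :=
    Icc_subset_Icc (by linarith) hm1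
  have hpt : ∀ t ∈ Icc (-(1 / (m + 1) : ℝ)) (1 / (m + 1)),
      AnalyticAt ℂ f (h m + h m ^ (-(β : ℂ)) * arcCurve β (h m) t) →
      ENNReal.ofReal (Real.posLog ‖1 / (f (h m *
        Complex.exp (Complex.I * (‖h m‖ ^ (-(1 + β)) * t : ℝ))) - c)‖) ≤
      ENNReal.ofReal (|α| * Real.log ‖h m‖ + Real.posLog A) +
        ENNReal.ofReal (Real.posLog ‖((s.map (arcCurve β (h m) t - ·)).prod)⁻¹‖) := by
    intro t ht han
    have hball : arcCurve β (h m) t ∈ Metric.ball (0 : ℂ) r := by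
      rw [mem_ball_zero_iff]
      exact ((norm_arcCurve_le hm0 t).trans (abs_le.2 ht)).trans_lt hnr
    have h1 := hsA _ hball han
    rw [add_mul_arcCurve hm0] at h1
    rw [← ENNReal.ofReal_add (add_nonneg (by positivity) Real.posLog_nonneg) Real.posLog_nonneg]
    refine ENNReal.ofReal_le_ofReal ?_
    refine (Real.posLog_le_posLog (norm_nonneg _) h1).trans ?_
    refine Real.posLog_mul.trans ?_
    have h2 : Real.posLog (‖h m‖ ^ (-α)) ≤ |α| * Real.log ‖h m‖ := by
      rw [Real.posLog_apply, Real.log_rpow (norm_pos_iff.2 hm0)]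
      exact max_le (by positivity) (mul_le_mul_of_nonneg_right (neg_le_abs α) hlog)
    have h3 : Real.posLog (A * ‖((s.map (arcCurve β (h m) t - ·)).prod)⁻¹‖) ≤ _ := Real.posLog_mul
    linarith
  -- The pointwise bound holds on the short arc only, where the curve stays in the disc of radius
  -- $r$; the majorant is then integrated over all of $[-1,1]$.
  calc _ ≤ ∫⁻ t in Icc (-(1 / (m + 1) : ℝ)) (1 / (m + 1)),
        (ENNReal.ofReal (|α| * Real.log ‖h m‖ + Real.posLog A) +
          ENNReal.ofReal (Real.posLog ‖((s.map (arcCurve β (h m) t - ·)).prod)⁻¹‖)) := by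
        refine MeasureTheory.lintegral_mono_ae ?_
        filter_upwards [MeasureTheory.ae_restrict_mem measurableSet_Icc,
          MeasureTheory.ae_restrict_of_ae (ae_analyticAt_arcCurve hβ hf.meromorphic (hh m))]
          with t ht han
        exact hpt t ht (han (hsub ht))
    _ ≤ ∫⁻ t in Icc (-1 : ℝ) 1,
        (ENNReal.ofReal (|α| * Real.log ‖h m‖ + Real.posLog A) +
          ENNReal.ofReal (Real.posLog ‖((s.map (arcCurve β (h m) t - ·)).prod)⁻¹‖)) :=
        MeasureTheory.lintegral_mono_set hsub
    _ ≤ ENNReal.ofReal (|α| * Real.log ‖h m‖ + Real.posLog A) * ENNReal.ofReal 2 +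
        ENNReal.ofReal (k * C) := by
        rw [MeasureTheory.lintegral_add_left measurable_const, MeasureTheory.setLIntegral_const,
          Real.volume_Icc, ENNReal.ofReal_mul (by positivity), ENNReal.ofReal_natCast,
          ENNReal.ofReal_coe_nnreal, ← hs, show (1 : ℝ) - -1 = 2 by norm_num]
        gcongr
    _ = ENNReal.ofReal ((|α| * Real.log ‖h m‖ + Real.posLog A) * 2 + k * C) := by
        have : 0 ≤ |α| * Real.log ‖h m‖ + Real.posLog A :=
          add_nonneg (by positivity) Real.posLog_nonneg
        rw [← ENNReal.ofReal_mul this, ← ENNReal.ofReal_add (by positivity) (by positivity)]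
    _ ≤ ENNReal.ofReal (m * (1 + Real.log ‖h m‖)) := by
        refine ENNReal.ofReal_le_ofReal ?_
        have h1 : 0 ≤ Real.posLog A := Real.posLog_nonneg
        have h2 : (0 : ℝ) ≤ k * C := by positivity
        have h3 := abs_nonneg α
        calc (|α| * Real.log ‖h m‖ + Real.posLog A) * 2 + k * C
            ≤ (2 * |α| + 2 * Real.posLog A + k * C + 1) * (1 + Real.log ‖h m‖) := by
              nlinarith [mul_nonneg h1 hlog, mul_nonneg h2 hlog]
          _ ≤ m * (1 + Real.log ‖h m‖) := by gcongr

end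

/-! ### Summation over the circle. -/

noncomputable section

/-- Uniform bounds for arcs of length comparable to `s` add up over the circle. -/
theorem lintegral_circle_le_of_arcs {Φ : ℝ → ENNReal} {σ s B : ℝ} (hσ : 0 < σ) (hs : 0 < s)
    (hs1 : s ≤ 1) (hB : 0 ≤ B)
    (harc : ∀ θ : ℝ, ∫⁻ t in Icc (-σ) σ, Φ (θ + s * t) ≤ ENNReal.ofReal B) :
    ∫⁻ θ in Ioc 0 (2 * Real.pi), Φ θ ≤ ENNReal.ofReal ((2 * Real.pi / σ + 1) * B) := by
  -- Centres are $\sigma s$ apart and arcs have half-width $\sigma s$. The change of variables gives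
  -- each arc a factor $s$, and $Ns\le 2\pi/\sigma+s\le 2\pi/\sigma+1$.
  set N := ⌊2 * Real.pi / (σ * s)⌋₊ + 1 with hN
  have hσs : 0 < σ * s := mul_pos hσ hs
  let arc : Fin N → Set ℝ := fun j ↦ (fun t ↦ σ * s * j + s * t) '' Icc (-σ) σ
  have hcover : Ioc 0 (2 * Real.pi) ⊆ ⋃ j, arc j := by
    intro θ hθ
    have h0 : 0 ≤ θ / (σ * s) := div_nonneg hθ.1.le hσs.le
    have h1 : ⌊θ / (σ * s)⌋₊ < N :=
      Nat.lt_succ_of_le (Nat.floor_le_floor (div_le_div_of_nonneg_right hθ.2 hσs.le))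
    have h2 := (le_div_iff₀ hσs).1 (Nat.floor_le h0)
    have h3 := (div_lt_iff₀ hσs).1 (Nat.lt_floor_add_one (θ / (σ * s)))
    refine mem_iUnion.2 ⟨⟨_, h1⟩, (θ - σ * s * ⌊θ / (σ * s)⌋₊) / s, ⟨?_, ?_⟩, ?_⟩
    · rw [le_div_iff₀ hs]; nlinarith
    · rw [div_le_iff₀ hs]; nlinarith
    · simp only
      field_simp
      ring
  have hint : ∀ j, ∫⁻ θ in arc j, Φ θ ≤ ENNReal.ofReal (s * B) := by
    intro j
    rw [MeasureTheory.lintegral_image_eq_lintegral_abs_deriv_mul (f' := fun _ ↦ s)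
      measurableSet_Icc (fun t _ ↦ by
        have := ((hasDerivAt_id t).const_mul s).const_add (σ * s * j)
        rw [mul_one] at this
        exact this.hasDerivWithinAt) (fun t _ t' _ h ↦ by
        simpa [hs.ne'] using h),
      MeasureTheory.lintegral_const_mul' _ _ ENNReal.ofReal_ne_top, abs_of_pos hs,
      ENNReal.ofReal_mul hs.le]
    gcongr
    exact harc _
  calc ∫⁻ θ in Ioc 0 (2 * Real.pi), Φ θ ≤ ∫⁻ θ in ⋃ j, arc j, Φ θ :=
        MeasureTheory.lintegral_mono_set hcover
    _ ≤ ∑' j, ∫⁻ θ in arc j, Φ θ := MeasureTheory.lintegral_iUnion_le _ _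
    _ ≤ ∑' _ : Fin N, ENNReal.ofReal (s * B) := ENNReal.tsum_le_tsum hint
    _ = ENNReal.ofReal (N * (s * B)) := by
        rw [tsum_fintype, Finset.sum_const, Finset.card_univ, Fintype.card_fin, nsmul_eq_mul,
          ENNReal.ofReal_mul (Nat.cast_nonneg N), ENNReal.ofReal_natCast]
    _ ≤ ENNReal.ofReal ((2 * Real.pi / σ + 1) * B) := by
        refine ENNReal.ofReal_le_ofReal ?_
        rw [← mul_assoc]
        refine mul_le_mul_of_nonneg_right ?_ hB
        have h1 : (⌊2 * Real.pi / (σ * s)⌋₊ : ℝ) ≤ 2 * Real.pi / (σ * s) :=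
          Nat.floor_le (div_nonneg Real.two_pi_pos.le hσs.le)
        have h2 : 2 * Real.pi / (σ * s) * s = 2 * Real.pi / σ := by field_simp
        rw [hN]
        push_cast
        nlinarith

/-- Passing through the lower integral avoids any integrability proof; the factor $1/(2\pi)\le1$ is
dropped. -/
theorem norm_circleAverage_le {u : ℂ → ℝ} {r D : ℝ} (hD : 0 ≤ D) (hu : ∀ z, 0 ≤ u z)
    (h : ∫⁻ θ in Ioc 0 (2 * Real.pi), ENNReal.ofReal (u (circleMap 0 r θ)) ≤ ENNReal.ofReal D) :
    ‖Real.circleAverage u 0 r‖ ≤ D := by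
  have h1 : ‖∫ θ in Ioc 0 (2 * Real.pi), u (circleMap 0 r θ)‖ₑ ≤ ENNReal.ofReal D := by
    refine (MeasureTheory.enorm_integral_le_lintegral_enorm _).trans ?_
    simpa only [Real.enorm_of_nonneg (hu _)] using h
  rw [← ofReal_norm, ENNReal.ofReal_le_ofReal_iff hD] at h1
  rw [Real.circleAverage_def, intervalIntegral.integral_of_le Real.two_pi_pos.le, norm_smul,
    norm_inv, Real.norm_of_nonneg Real.two_pi_pos.le]
  refine (mul_le_of_le_one_left (norm_nonneg _) (inv_le_one_of_one_le₀ ?_)).trans h1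
  linarith [Real.two_le_pi]

end

theorem theorem12 (α β : ℝ) (hβ : -1 ≤ β) (f : ℂ → ℂ) (hf : IsGeneralisedYosida α β f) (c : ℂ) :
    (fun r : ℝ ↦ ValueDistribution.proximity (fun z ↦ 1 / (f z - c)) ⊤ r) =O[atTop]
      fun r : ℝ ↦ Real.log r := by
  obtain ⟨σ, hσ, C, R, hC, hR, harc⟩ := hf.exists_lintegral_arc_le hβ c
  -- The $2$ comes from $1+\log r\le 2\log r$ for $r\ge e$.
  refine Asymptotics.IsBigO.of_bound ((2 * Real.pi / σ + 1) * (C * 2)) ?_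
  filter_upwards [eventually_ge_atTop R, eventually_ge_atTop (Real.exp 1)] with r hrR hre
  have hr1 : 1 ≤ r := hR.trans hrR
  have hr0 : 0 < r := by linarith
  have hlog : 1 ≤ Real.log r := by rwa [Real.le_log_iff_exp_le hr0]
  have hπ := Real.pi_pos
  rw [ValueDistribution.proximity_top, Real.norm_of_nonneg (by linarith : 0 ≤ Real.log r)]
  refine norm_circleAverage_le (by positivity) (fun _ ↦ Real.posLog_nonneg) ?_
  refine (lintegral_circle_le_of_arcs hσ (s := r ^ (-(1 + β))) (by positivity)
    (Real.rpow_le_one_of_one_le_of_nonpos hr1 (by linarith)) (B := C * (1 + Real.log r))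
    (by positivity) fun θ ↦ ?_).trans (ENNReal.ofReal_le_ofReal ?_)
  · have hnorm : ‖circleMap 0 r θ‖ = r := by simp [abs_of_pos hr0]
    have h1 := harc (circleMap 0 r θ) (by rwa [hnorm])
    rw [hnorm] at h1
    refine le_trans (le_of_eq ?_) h1
    refine MeasureTheory.lintegral_congr fun t ↦ ?_
    have e : circleMap 0 r (θ + r ^ (-(1 + β)) * t) =
        circleMap 0 r θ * Complex.exp (Complex.I * (r ^ (-(1 + β)) * t : ℝ)) := by
      rw [circleMap_zero, circleMap_zero, mul_assoc, ← Complex.exp_add]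
      push_cast
      ring_nf
    rw [e]
  · rw [mul_assoc (2 * Real.pi / σ + 1), mul_assoc C]
    gcongr
    linarith
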